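/- Let $p$ be a prime, let $X$ be an integral, separated, Noetherian scheme of characteristic $p$ with generic point $\eta$ and function field $L$, and let $\mathcal D$ be a Cartier subalgebra on $X$. Definitions. (1) A map $\psi:K\to K$ on a field $K$ of characteristic $p$ is $p^{-e}$-linear if it is additive and $\psi(f^{p^e}g)=f\psi(g)$ for all $f,g\in K$. Let $\mathcal C^X_e$ be the sheaf whose sections over a nonempty open $U$ are the $p^{-e}$-linear maps $\psi$ on $L$ with $\psi(\mathcal O_X(V))\subseteq\mathcal O_X(V)$ for all nonempty open $V\subseteq U$. A Cartier subalgebra is a quasi-coherent sheaf of graded subrings (under composition) $\mathcal D=\bigoplus_{e\ge0}\mathcal D_e\subseteq\bigoplus_{e\ge 0}\mathcal C^X_e$ with $\mathcal D_0=\mathcal C^X_0=\mathcal O_X$. (2) A semivaluation on $X$ is a pair $\zeta=(w,y)$ of a point $y\in X$ (the home of $\zeta$) and a valuation $w:\kappa(y)\to\mathbb R\cup\{+\infty\}$ (the trivial one is allowed) that is nonnegative on the subring $\mathcal O_{Z,z}\subseteq\kappa(y)$ for some $z\in Z=\overline{\{y\}}$. Its center is the unique $z\in Z$ such that $w\ge0$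 on $\mathcal O_{Z,z}$ and $w>0$ on the maximal ideal of $\mathcal O_{Z,z}$. Let $X^\beth$ be the set of semivaluations on $X$. For $U\subseteq X$ affine open, $U^\beth\subseteq X^\beth$ carries the weakest topology such that $\zeta\mapsto\zeta(f):=w(f(y))\in[0,\infty]$ is continuous for all $f\in\mathcal O_X(U)$; a subset of $X^\beth$ is open if its intersection with $U^\beth$ is open in $U^\beth$ for every affine open $U$. The set $\mathfrak D(X)$ of $\mathbb Z$-semivaluations is the closure in $X^\beth$ of the set of those semivaluations with home $\eta$ all of whose finite values lie in $\mathbb Z$. (3) Let $Z=\overline{\{y\}}$ have ideal sheaf $\mathcal I_Z$. Then $Z$ is uniformly $\mathcal D$-compatible if $\psi(\mathcal I_{Z,x})\subseteq\mathcal I_{Z,x}$ for all $x\in X$, $e\ge1$ and $\psi\in(\mathcal D_e)_x$. In this case let $(\mathcal D\|_Z)_{e,z}$ be the set of the $p^{-e}$-linear maps on $\kappa(y)$ that are induced by the elements of $(\mathcal D_e)_z$, for $z\in Z$. For $\zeta=(w,y)$ with center $z$ put $$A(\zeta;\mathcal D)=\sup_{e\ge1}\ \sup_{0\ne\varphi\in(\mathcal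 D\|_Z)_{e,z}}\ \sup_{n\ge1,\ 0\neq f\in\kappa(y)}\frac{w(f)-p^{ne}\,w(\varphi^n(f))}{p^{ne}-1}\in[-\infty,\infty]$$ if $Z$ is uniformly $\mathcal D$-compatible (with $\sup\varnothing=-\infty$), and $A(\zeta;\mathcal D)=+\infty$ otherwise. (4) $\mathrm{mld}_\beth(x;\mathcal D)=\inf A(\zeta;\mathcal D)$ over all $\zeta\in\mathfrak D(X)$ with center $x$, for $x\in X$. Theorem. For each $x\in X$ the infimum in (4) is a minimum: it is attained at some $\zeta\in\mathfrak D(X)$ with center $x$. The function $\mathrm{mld}_\beth(-;\mathcal D):X\to[-\infty,+\infty]$ is lower semicontinuous in the constructible topology on $X$. Explicitly, let $x\in X$. If $\mathrm{mld}_\beth(x;\mathcal D)$ is finite, then for every $\varepsilon>0$ there is a locally closed subset $G\subseteq X$ containing $x$ with $\mathrm{mld}_\beth(x';\mathcal D)>\mathrm{mld}_\beth(x;\mathcal D)-\varepsilon$ for all $x'\in G$. If $\mathrm{mld}_\beth(x;\mathcal D)=+\infty$, then for every real $M$ there is a locally closed $G\subseteq X$ containing $x$ with $\mathrm{mld}_\beth(x';\mathcal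 D)>M$ for all $x'\in G$. -/

import Mathlib

open AlgebraicGeometry CategoryTheory Topology TopologicalSpace

universe u

noncomputable section

namespace BethMLD

/-! ### `p^{-e}`-linear maps and Cartier subalgebras -/

/-- An additive map `ψ` on a field is `p^{-e}`-linear if `ψ (f ^ (p ^ e) * g) = f * ψ g`. -/
def IsPInvLinear {K : Type*} [Field K] (p e : ℕ) (ψ : K →+ K) : Prop :=
  ∀ f g : K, ψ (f ^ (p ^ e) * g) = f * ψ g

/-- The sections over a nonempty open `U` of the degree `e` part of the Cartier algebra of `X`:
the `p^{-e}`-linear maps on the function field that preserve the subring `𝒪_X(V)`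
for each nonempty open `V ⊆ U`. -/
def cartierSections (p : ℕ) (X : Scheme.{u}) [IsIntegral X] (e : ℕ) (U : X.Opens) :
    AddSubgroup (X.functionField →+ X.functionField) where
  carrier := {ψ | IsPInvLinear p e ψ ∧
    ∀ (V : X.Opens) [Nonempty V], V ≤ U → ∀ a : Γ(X, V),
      ∃ b : Γ(X, V), X.germToFunctionField V b = ψ (X.germToFunctionField V a)}
  zero_mem' := ⟨fun _ _ => by simp, fun V _ _ _ => ⟨0, by simp⟩⟩
  add_mem' := by
    rintro ψ φ ⟨h1, h2⟩ ⟨h3, h4⟩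
    refine ⟨fun f g => by simp [h1 f g, h3 f g, mul_add], fun V _ hV a => ?_⟩
    obtain ⟨b, hb⟩ := h2 V hV a
    obtain ⟨c, hc⟩ := h4 V hV a
    exact ⟨b + c, by simp [hb, hc]⟩
  neg_mem' := by
    rintro ψ ⟨h1, h2⟩
    refine ⟨fun f g => by simp [h1 f g], fun V _ hV a => ?_⟩
    obtain ⟨b, hb⟩ := h2 V hV a
    exact ⟨-b, by simp [hb]⟩

/-- A Cartier subalgebra on an integral scheme `X`: a quasi-coherent sheaf of graded subrings
of the Cartier algebra whose degree zero part is `𝒪_X`. All sections over nonempty opens are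
regarded as additive endomorphisms of the function field; since `X` is irreducible, compatible
local sections are given by one and the same endomorphism. -/
structure CartierSubalgebra (p : ℕ) (X : Scheme.{u}) [IsIntegral X] where
  /-- the sections of the degree `e` part over a nonempty open `U` -/
  sections (e : ℕ) (U : X.Opens) [Nonempty U] : AddSubgroup (X.functionField →+ X.functionField)
  le_cartier (e : ℕ) (U : X.Opens) [Nonempty U] : sections e U ≤ cartierSections p X e U
  restrict (e : ℕ) (U V : X.Opens) [Nonempty U] [Nonempty V] (h : V ≤ U) :
    sections e U ≤ sections e V
  glue (e : ℕ) (U : X.Opens) [Nonempty U] (ψ : X.functionField →+ X.functionField)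
    (h : ∀ x ∈ U, ∃ (V : X.Opens) (_ : Nonempty V), x ∈ V ∧ V ≤ U ∧ ψ ∈ sections e V) :
    ψ ∈ sections e U
  degree_zero (U : X.Opens) [Nonempty U] : sections 0 U = cartierSections p X 0 U
  comp_mem (d e : ℕ) (U : X.Opens) [Nonempty U] (ψ φ : X.functionField →+ X.functionField)
    (hψ : ψ ∈ sections d U) (hφ : φ ∈ sections e U) : ψ.comp φ ∈ sections (d + e) U
  /-- quasi-coherence: over an affine open `U`, each section over the basic open of `s`
  becomes a section over `U` after multiplication by a power of `s` -/
  quasiCoherent (e : ℕ) (U : X.Opens) [Nonempty U] (hU : IsAffineOpen U) (s : Γ(X, U))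
    [Nonempty (X.basicOpen s)] (ψ : X.functionField →+ X.functionField)
    (hψ : ψ ∈ sections e (X.basicOpen s)) :
    ∃ n : ℕ, (AddMonoidHom.mulLeft (X.germToFunctionField U s ^ n)).comp ψ ∈ sections e U

/-- The stalk at `x` of the degree `e` part of a Cartier subalgebra. -/
def CartierSubalgebra.stalk {p : ℕ} {X : Scheme.{u}} [IsIntegral X] (D : CartierSubalgebra p X)
    (e : ℕ) (x : X) : Set (X.functionField →+ X.functionField) :=
  {ψ | ∃ (U : X.Opens) (_ : Nonempty U), x ∈ U ∧ ψ ∈ D.sections e U}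

/-- For `z` in the closure of `x`, the map `𝒪_{X,z} ⟶ 𝒪_{X,x} ⟶ κ(x)`. Its kernel is the stalk
at `z` of the ideal of `Z = closure {x}`, and its image is the local ring `𝒪_{Z,z}`. -/
def stalkToResidueField {X : Scheme.{u}} {x z : X} (h : x ⤳ z) :
    X.presheaf.stalk z →+* X.residueField x :=
  (X.presheaf.stalkSpecializes h ≫ X.residue x).hom

/-- The closure `Z` of `x` is uniformly compatible with `D`. (At points outside of `Z` the ideal
of `Z` is the unit ideal and there is no condition.) -/
def UniformlyCompatible {p : ℕ} {X : Scheme.{u}} [IsIntegral X] (D : CartierSubalgebra p X)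
    (x : X) : Prop :=
  ∀ (z : X) (h : x ⤳ z) (e : ℕ), 1 ≤ e → ∀ ψ ∈ D.stalk e z,
    ∀ a : X.presheaf.stalk z, stalkToResidueField h a = 0 →
      ∃ b : X.presheaf.stalk z, stalkToResidueField h b = 0 ∧
        algebraMap (X.presheaf.stalk z) X.functionField b =
          ψ (algebraMap (X.presheaf.stalk z) X.functionField a)

/-- `φ : κ(x) → κ(x)` is induced by `ψ : L → L`, where `L` is the function field of `X`:
`ψ` maps `𝒪_{X,x}` to itself and `φ` is the map it induces modulo the maximal ideal. -/
def Induces {X : Scheme.{u}} [IsIntegral X] (x : X) (ψ : X.functionField →+ X.functionField)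
    (φ : X.residueField x →+ X.residueField x) : Prop :=
  ∀ a : X.presheaf.stalk x, ∃ b : X.presheaf.stalk x,
    algebraMap (X.presheaf.stalk x) X.functionField b =
        ψ (algebraMap (X.presheaf.stalk x) X.functionField a) ∧
      φ (X.residue x a) = X.residue x b

/-- The stalk at `z` of the degree `e` part of the exceptional restriction of `D` to the closure
`Z` of `x`, as a set of maps on the function field `κ(x)` of `Z`. -/
def exceptionalStalk {p : ℕ} {X : Scheme.{u}} [IsIntegral X] (D : CartierSubalgebra p X)
    (x z : X) (e : ℕ) : Set (X.residueField x →+ X.residueField x) :=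
  {φ | ∃ ψ ∈ D.stalk e z, Induces x ψ φ}

/-! ### Semivaluations -/

/-- A semivaluation on `X`: a point `x` (the home) and a real valuation on `κ(x)`, possibly
trivial, that is nonnegative on the local ring `𝒪_{Z,z} ⊆ κ(x)` for some point `z` of the
closure `Z` of `x`. -/
structure Semivaluation (X : Scheme.{u}) where
  home : X
  val : AddValuation (X.residueField home) (WithTop ℝ)
  centered : ∃ (z : X) (h : home ⤳ z), ∀ a, 0 ≤ val (stalkToResidueField h a)

variable {X : Scheme.{u}}

/-- `z` is the center of `ζ`: the valuation ring of `ζ` dominates `𝒪_{Z,z}`, where `Z` is the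
closure of the home of `ζ`. -/
def Semivaluation.IsCenter (ζ : Semivaluation X) (z : X) : Prop :=
  ∃ h : ζ.home ⤳ z, ∀ a : X.presheaf.stalk z,
    0 ≤ ζ.val (stalkToResidueField h a) ∧
      (a ∈ IsLocalRing.maximalIdeal (X.presheaf.stalk z) → 0 < ζ.val (stalkToResidueField h a))

/-- The inclusion of `ℝ ∪ {+∞}` into the extended real line. -/
def toEReal (a : WithTop ℝ) : EReal := WithBot.some a

/-- The semivaluations on the open subscheme `U`, as a subset of those on `X`. -/
def bethOpen (U : X.Opens) : Set (Semivaluation X) :=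
  {ζ | ∃ z ∈ U, ∃ h : ζ.home ⤳ z, ∀ a, 0 ≤ ζ.val (stalkToResidueField h a)}

lemma home_mem_of_mem_bethOpen {U : X.Opens} {ζ : Semivaluation X} (h : ζ ∈ bethOpen U) :
    ζ.home ∈ U := by
  obtain ⟨z, hz, hs, -⟩ := h
  exact hs.mem_open U.isOpen hz

/-- The evaluation `ζ ↦ ζ(f)`, for a section `f` over `U`. -/
def ev (U : X.Opens) (f : Γ(X, U)) (ζ : bethOpen U) : EReal :=
  toEReal (ζ.1.val (X.evaluation U ζ.1.home (home_mem_of_mem_bethOpen ζ.2) f))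

/-- The topology on the set of semivaluations on the open subscheme `U`, for `U` affine: the
weakest one such that all evaluations at sections over `U` are continuous. -/
@[reducible]
def bethOpenTopology (U : X.Opens) : TopologicalSpace (bethOpen U) :=
  ⨅ f : Γ(X, U), TopologicalSpace.induced (ev U f) inferInstance

/-- The topology on the set of semivaluations on `X`: a subset is open if and only if its
intersection with the semivaluations on `U` is open there, for each affine open `U`. -/
instance bethTopology : TopologicalSpace (Semivaluation X) :=
  ⨆ U : X.affineOpens,
    TopologicalSpace.coinduced (Subtype.val : bethOpen U.1 → Semivaluation X)
      (bethOpenTopology U.1)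

/-- The `ℤ`-valuations on an integral scheme: valuations on the function field that are centered
on `X` and take finite values in `ℤ` only. -/
def zValuations (X : Scheme.{u}) [IsIntegral X] : Set (Semivaluation X) :=
  {ζ | ζ.home = genericPoint X ∧ ∀ a, a ≠ 0 → ∃ n : ℤ, ζ.val a = ((n : ℝ) : WithTop ℝ)}

/-- The `ℤ`-semivaluations: the closure of the set of `ℤ`-valuations. -/
def zSemivaluations (X : Scheme.{u}) [IsIntegral X] : Set (Semivaluation X) :=
  closure (zValuations X)

/-! ### Log discrepancies -/

/-- `E(f, ψ, v) = (v(f) - p^e v(ψ(f))) / (p^e - 1)` for a `p^{-e}`-linear map `ψ`. -/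
def discrepancyTerm {K : Type*} [Field K] (p e : ℕ) (v : AddValuation K (WithTop ℝ))
    (ψ : K → K) (f : K) : EReal :=
  (toEReal (v f) - (((p : ℝ) ^ e : ℝ) : EReal) * toEReal (v (ψ f))) /
    (((p : ℝ) ^ e - 1 : ℝ) : EReal)

/-- The log discrepancy at `v` of a nonzero `p^{-e}`-linear map `ψ` on a field. -/
def mapLogDiscrepancy {K : Type*} [Field K] (p e : ℕ) (v : AddValuation K (WithTop ℝ))
    (ψ : K →+ K) : EReal :=
  ⨆ (n : ℕ) (_ : 1 ≤ n) (f : K) (_ : f ≠ 0), discrepancyTerm p (n * e) v (ψ^[n]) f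

open Classical in
/-- The log discrepancy `A(ζ; D)`: the log discrepancy of the exceptional restriction of `D` to
the closure of the home of `ζ` if the latter is uniformly compatible with `D`, and `+∞` if not.
(For a valuation on the function field of `X`, the exceptional restriction is `D` itself.) -/
def logDiscrepancy {p : ℕ} [IsIntegral X] (D : CartierSubalgebra p X) (ζ : Semivaluation X) :
    EReal :=
  if UniformlyCompatible D ζ.home then
    ⨆ (z : X) (_ : ζ.IsCenter z) (e : ℕ) (_ : 1 ≤ e) (φ ∈ exceptionalStalk D ζ.home z e)
      (_ : φ ≠ 0), mapLogDiscrepancy p e ζ.val φ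
  else ⊤

/-- The minimal `ℶ` log discrepancy of `D` at `x`, as an infimum. -/
def mld {p : ℕ} [IsIntegral X] (D : CartierSubalgebra p X) (x : X) : EReal :=
  ⨅ (ζ ∈ zSemivaluations X) (_ : ζ.IsCenter x), logDiscrepancy D ζ

end BethMLD

end

/-! Over an affine open `V`, a semivaluation is the same as a valuation `Γ(X, V) → [0, ∞]`: its home
is the prime where the value is `∞`, its center the prime where the value is positive. The valuation
axioms are closed conditions, so the space of semivaluations on `V` is compact
(`compactSpace_bethOpen`).

On this space the log discrepancy is the supremum of the functions `ζ ↦ (ζ(f) - q ζ(b)) / (q - 1)`,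
where `q = p ^ e`, `ψ` is a section of `D` of degree `e ≥ 1` over `V`, and `b = ψ(f)`
(`logDiscrepancy_eq`). Stalks reduce to sections by clearing denominators. Failure of compatibility
shows up as some `f` with `ζ(f) = ∞` and `ζ(ψ(f)) < ∞`, which gives the prescribed value `+∞`. Each
function is lower semicontinuous, hence so is the log discrepancy.

Integrality enters through a gap: on the local ring of its center, a `ℤ`-semivaluation takes values
in `{0} ∪ [1, ∞]`, and this survives passage to the closure. Therefore `ζ(f) > 0` is a clopen
condition on `ℤ`-semivaluations, and the center map is continuous for the constructible topology.
Its fibres are compact, and nonempty because every Noetherian local domain is dominated by a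
`ℤ`-valued valuation, so the infimum is attained. The set where `mld ≤ t` is then a finite union of
images of compact sets in a Hausdorff space, hence closed. -/

/-! ### The Krull–Akizuki theorem. -/

-- Multiplication by `a` embeds `T/I` in `T/aI` with cokernel `T/aT`, while `I/aI` lies in `T/aI`
-- with quotient `T/I`. Comparing lengths and cancelling the finite length of `T/I` even gives
-- equality.
open scoped Pointwise in
lemma Ideal.length_quotSMulTop_le {T : Type*} [CommRing T] [IsDomain T] [IsNoetherianRing T]
    [Ring.KrullDimLE 1 T] {a : T} (ha : a ≠ 0) {I : Ideal T} (hI : I ≠ ⊥) :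
    Module.length T (QuotSMulTop a I) ≤ Ring.ord T a := by
  obtain ⟨b, hbI, hb⟩ := Submodule.exists_mem_ne_zero_of_ne_bot hI
  have hfin : Module.length T (T ⧸ I) ≠ ⊤ := by
    refine ne_top_of_le_ne_top (Ring.ord_ne_top (mem_nonZeroDivisors_of_ne_zero hb)) ?_
    exact Module.length_le_of_surjective
      (Submodule.factor ((Ideal.span_singleton_le_iff_mem I).2 hbI))
      (Submodule.factor_surjective _)
  have h1 := Module.length_eq_add_of_exact (Ideal.mulQuot a I) (Ideal.quotOfMul a I)
    (Ideal.mulQuot_injective I (mem_nonZeroDivisors_of_ne_zero ha))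
    (Ideal.quotOfMul_surjective I) (Ideal.exact_mulQuot_quotOfMul I)
  have hle : a • I ≤ I := Submodule.smul_le_self_of_tower a I
  have hker : LinearMap.ker ((a • I).mkQ ∘ₗ I.subtype) = a • (⊤ : Submodule T I) := by
    ext x
    simp only [LinearMap.mem_ker, LinearMap.comp_apply, Submodule.mkQ_apply,
      Submodule.Quotient.mk_eq_zero, Submodule.mem_smul_pointwise_iff_exists]
    constructor
    · rintro ⟨y, hy, hxy⟩
      exact ⟨⟨y, hy⟩, trivial, Subtype.ext hxy⟩
    · rintro ⟨y, -, hxy⟩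
      exact ⟨y, y.2, congrArg Subtype.val hxy⟩
  let f : QuotSMulTop a I →ₗ[T] T ⧸ (a • I) :=
    Submodule.liftQ _ ((a • I).mkQ ∘ₗ I.subtype) hker.ge
  have hf : Function.Injective f := by
    rw [← LinearMap.ker_eq_bot]
    exact Submodule.ker_liftQ_eq_bot _ _ _ hker.le
  have hex : Function.Exact f (Submodule.factor hle) := by
    intro y
    obtain ⟨y, rfl⟩ := Submodule.mkQ_surjective _ y
    have hy' : Submodule.factor hle ((a • I).mkQ y) = 0 ↔ y ∈ I :=
      Submodule.Quotient.mk_eq_zero I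
    rw [hy', Set.mem_range]
    constructor
    · intro hy
      exact ⟨Submodule.Quotient.mk ⟨y, hy⟩, rfl⟩
    · rintro ⟨x, hx⟩
      obtain ⟨x, rfl⟩ := Submodule.mkQ_surjective _ x
      have : (Submodule.Quotient.mk x.1 : T ⧸ (a • I)) = Submodule.Quotient.mk y := hx
      rw [Submodule.Quotient.eq] at this
      have h2 := I.sub_mem x.2 (hle this)
      simpa using h2
  have h2 := Module.length_eq_add_of_exact f (Submodule.factor hle) hf
    (Submodule.factor_surjective _) hex
  rw [h1, add_comm] at h2
  exact (WithTop.add_right_cancel hfin h2).ge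

/-- A ring extension `B` of a domain `T` all of whose elements are fractions of elements of `T`. -/
def IsFractionExtension (T B : Type*) [CommRing T] [CommRing B] [Algebra T B] : Prop :=
  ∀ b : B, ∃ s t : T, s ≠ 0 ∧ s • b = algebraMap T B t

-- A finitely generated `M` has a common denominator `d`, and `M ≅ dM` is then an ideal of `T`.
open scoped Pointwise in
lemma IsFractionExtension.length_quotSMulTop_le {T B : Type*} [CommRing T] [IsDomain T]
    [IsNoetherianRing T] [Ring.KrullDimLE 1 T] [CommRing B] [IsDomain B] [Algebra T B]
    [FaithfulSMul T B] (hB : IsFractionExtension T B) {a : T} (ha : a ≠ 0) {M : Submodule T B}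
    (hM : M.FG) : Module.length T (QuotSMulTop a M) ≤ Ring.ord T a := by
  by_cases hbot : M = ⊥
  · subst hbot
    have : Subsingleton (QuotSMulTop a (⊥ : Submodule T B)) :=
      (Submodule.mkQ_surjective _).subsingleton
    simp [Module.length_eq_zero]
  have hd : ∃ d : T, d ≠ 0 ∧ ∀ m ∈ M, ∃ t : T, d • m = algebraMap T B t := by
    clear hbot
    induction M, hM using Submodule.fg_induction with
    | singleton x =>
      obtain ⟨s, t, hs, hst⟩ := hB x
      refine ⟨s, hs, fun m hm => ?_⟩
      obtain ⟨c, rfl⟩ := Submodule.mem_span_singleton.1 hm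
      exact ⟨c * t, by rw [smul_comm, hst, map_mul, Algebra.smul_def]⟩
    | sup M N _ _ h1 h2 =>
      obtain ⟨d, hd, h1⟩ := h1
      obtain ⟨e, he, h2⟩ := h2
      refine ⟨d * e, mul_ne_zero hd he, fun m hm => ?_⟩
      obtain ⟨x, hx, y, hy, rfl⟩ := Submodule.mem_sup.1 hm
      obtain ⟨t, ht⟩ := h1 x hx
      obtain ⟨r, hr⟩ := h2 y hy
      refine ⟨e * t + d * r, ?_⟩
      rw [smul_add, mul_comm d e, mul_smul, ht, mul_comm e d, mul_smul, hr]
      simp [Algebra.smul_def]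
  obtain ⟨d, hd0, hd⟩ := hd
  have hinj : Function.Injective (algebraMap T B) := FaithfulSMul.algebraMap_injective T B
  have hd1 : Function.Injective (LinearMap.lsmul T B d) := by
    intro x y hxy
    simp only [LinearMap.lsmul_apply, Algebra.smul_def] at hxy
    exact mul_left_cancel₀ (by simpa using hinj.ne hd0) hxy
  let N : Submodule T B := M.map (LinearMap.lsmul T B d)
  let I : Submodule T T := N.comap (Algebra.linearMap T B)
  have hI : I.map (Algebra.linearMap T B) = N := by
    refine Submodule.map_comap_eq_of_le ?_
    rintro _ ⟨m, hm, rfl⟩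
    obtain ⟨t, ht⟩ := hd m hm
    exact ⟨t, ht.symm⟩
  let e : M ≃ₗ[T] I := (Submodule.equivMapOfInjective _ hd1 M).trans
    ((LinearEquiv.ofEq _ _ hI.symm).trans
      (Submodule.equivMapOfInjective (Algebra.linearMap T B) hinj I).symm)
  rw [(QuotSMulTop.congr a e).length_eq]
  refine Ideal.length_quotSMulTop_le ha fun h => hbot ?_
  have := e.toEquiv.subsingleton_congr.2 (by rw [h]; infer_instance)
  exact (Submodule.subsingleton_iff_eq_bot).1 this

-- Every finitely generated submodule of `B/aB` is a quotient of some `M/aM` with `M` finitely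
-- generated, so its length is at most that of `T/aT`. A uniform bound on lengths excludes infinite
-- ascending chains of such submodules.
open scoped Pointwise in
lemma IsFractionExtension.isNoetherian_quotSMulTop {T B : Type*} [CommRing T] [IsDomain T]
    [IsNoetherianRing T] [Ring.KrullDimLE 1 T] [CommRing B] [IsDomain B] [Algebra T B]
    [FaithfulSMul T B] (hB : IsFractionExtension T B) {a : T} (ha : a ≠ 0) :
    IsNoetherian T (QuotSMulTop a B) := by
  have hfg : ∀ N : Submodule T (QuotSMulTop a B), N.FG → Module.length T N ≤ Ring.ord T a := by
    intro N hN
    obtain ⟨M, hM, rfl⟩ : ∃ M : Submodule T B, M.FG ∧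
        M.map (Submodule.mkQ (a • (⊤ : Submodule T B))) = N := by
      obtain ⟨s, hs, rfl⟩ := Submodule.fg_def.1 hN
      have hsurj := Submodule.mkQ_surjective (a • (⊤ : Submodule T B))
      refine ⟨Submodule.span T (Function.surjInv hsurj '' s),
        Submodule.fg_span (hs.image _), ?_⟩
      rw [Submodule.map_span, ← Set.image_comp]
      congr 1
      convert! Set.image_id s using 1
      exact Set.image_congr fun x _ => Function.surjInv_eq hsurj x
    refine le_trans ?_ (hB.length_quotSMulTop_le ha hM)
    let f : QuotSMulTop a M →ₗ[T] M.map (Submodule.mkQ (a • (⊤ : Submodule T B))) :=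
      Submodule.liftQ _ ((Submodule.mkQ (a • (⊤ : Submodule T B))).submoduleMap M) (by
        rintro _ ⟨m, -, rfl⟩
        rw [LinearMap.mem_ker]
        ext
        simp only [LinearMap.submoduleMap_coe_apply]
        exact (Submodule.Quotient.mk_eq_zero _).2 ⟨m, trivial, rfl⟩)
    refine Module.length_le_of_surjective f ?_
    rintro ⟨_, m, hm, rfl⟩
    exact ⟨Submodule.Quotient.mk ⟨m, hm⟩, rfl⟩
  have hlt := Ring.ord_ne_top (mem_nonZeroDivisors_of_ne_zero ha)
  rw [isNoetherian_iff_fg_wellFounded]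
  have hanti : StrictAnti fun N : {N : Submodule T (QuotSMulTop a B) // N.FG} =>
      (Ring.ord T a).toNat - (Module.length T N.1).toNat := by
    intro N N' hNN'
    have h1 := ne_top_of_le_ne_top hlt (hfg N'.1 N'.2)
    have h2 := ENat.toNat_le_toNat (hfg N'.1 N'.2) hlt
    have h3 := isFiniteLength_iff_isNoetherian_isArtinian.1 (Module.length_ne_top_iff.1 h1)
    have := h3.1
    have := h3.2
    have h4 : Module.length T N.1 < Module.length T N'.1 := by
      have e : Module.length T (N.1.submoduleOf N'.1) = Module.length T N.1 :=
        LinearEquiv.length_eq (Submodule.submoduleOfEquivOfLe hNN'.le)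
      rw [← e]
      refine Submodule.length_lt fun h => hNN'.not_ge ?_
      exact Submodule.submoduleOf_eq_top.1 h
    have h5 : (Module.length T N.1).toNat < (Module.length T N'.1).toNat := by
      rw [← ENat.natCast_lt_natCast, ENat.natCast_toNat h4.ne_top, ENat.natCast_toNat h1]
      exact h4
    show (Ring.ord T a).toNat - (Module.length T N'.1).toNat <
      (Ring.ord T a).toNat - (Module.length T N.1).toNat
    omega
  exact hanti.wellFoundedGT

/-- The theorem of Krull and Akizuki. -/
lemma IsFractionExtension.isNoetherianRing {T B : Type*} [CommRing T] [IsDomain T]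
    [IsNoetherianRing T] [Ring.KrullDimLE 1 T] [CommRing B] [IsDomain B] [Algebra T B]
    [FaithfulSMul T B] (hB : IsFractionExtension T B) : IsNoetherianRing B := by
  rw [isNoetherianRing_iff_ideal_fg]
  intro J
  by_cases hJ : J = ⊥
  · rw [hJ]; exact Submodule.fg_bot
  -- Clearing the denominator of `b` puts a nonzero `a ∈ T` into `J`. As `B/aB` is Noetherian, `J`
  -- is finitely generated modulo `aB`.
  obtain ⟨b, hbJ, hb⟩ := Submodule.exists_mem_ne_zero_of_ne_bot hJ
  obtain ⟨s, a, hs, hst⟩ := hB b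
  have hinj : Function.Injective (algebraMap T B) := FaithfulSMul.algebraMap_injective T B
  have ha : a ≠ 0 := by
    rintro rfl
    rw [map_zero, Algebra.smul_def] at hst
    exact mul_ne_zero (by simpa using hinj.ne hs) hb hst
  have haJ : algebraMap T B a ∈ J := by
    rw [← hst, Algebra.smul_def]
    exact J.mul_mem_left _ hbJ
  have := hB.isNoetherian_quotSMulTop ha
  let A : Ideal B := Ideal.span {algebraMap T B a}
  let f : QuotSMulTop a B →ₗ[T] B ⧸ A :=
    Submodule.liftQ _ (A.mkQ.restrictScalars T) (by
      rintro _ ⟨m, -, rfl⟩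
      refine (Submodule.Quotient.mk_eq_zero A).2 ?_
      show a • m ∈ A
      rw [Algebra.smul_def]
      exact A.mul_mem_right _ (Ideal.mem_span_singleton_self _))
  have hf : Function.Surjective f := by
    intro y
    obtain ⟨y, rfl⟩ := Submodule.mkQ_surjective _ y
    exact ⟨Submodule.Quotient.mk y, rfl⟩
  have : _root_.IsNoetherian T (B ⧸ A) := isNoetherian_of_surjective f (LinearMap.range_eq_top.2 hf)
  have : _root_.IsNoetherian B (B ⧸ A) := isNoetherian_of_tower T this
  refine Submodule.fg_of_fg_map_of_fg_inf_ker A.mkQ (IsNoetherian.noetherian _) ?_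
  rw [Submodule.ker_mkQ, inf_eq_right.2 ((Ideal.span_singleton_le_iff_mem J).2 haJ)]
  exact ⟨{algebraMap T B a}, by simp⟩

/-! ### Domination of Noetherian local domains by `ℤ`-valued valuations. -/

open scoped WithZero

/-- The real additive valuation attached to a valuation with values in `ℤᵐ⁰`. -/
noncomputable def Valuation.toRealAddValuation {K : Type*} [Field K] (v : Valuation K ℤᵐ⁰) :
    AddValuation K (WithTop ℝ) := by
  classical
  exact AddValuation.of
    (fun x => if x = 0 then ⊤ else ((-(WithZero.log (v x)) : ℤ) : ℝ))
    (by simp) (by simp)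
    (fun x y => by
      by_cases hx : x = 0
      · simp [hx]
      by_cases hy : y = 0
      · simp [hy]
      by_cases hxy : x + y = 0
      · simp [hxy]
      have h := v.map_add x y
      have hx' := (v.ne_zero_iff).2 hx
      have hy' := (v.ne_zero_iff).2 hy
      have hxy' := (v.ne_zero_iff).2 hxy
      simp only [hx, hy, hxy, if_false]
      rw [le_max_iff, ← WithZero.log_le_log hxy' hx', ← WithZero.log_le_log hxy' hy'] at h
      rw [min_le_iff, WithTop.coe_le_coe, WithTop.coe_le_coe, Int.cast_le, Int.cast_le]
      omega)
    (fun x y => by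
      by_cases hx : x = 0
      · simp [hx]
      by_cases hy : y = 0
      · simp [hy]
      have hx' := (v.ne_zero_iff).2 hx
      have hy' := (v.ne_zero_iff).2 hy
      simp only [mul_eq_zero, hx, hy, or_self, if_false, map_mul, WithZero.log_mul hx' hy']
      rw [← WithTop.coe_add, ← Int.cast_add]
      congr 2
      omega)

lemma Valuation.toRealAddValuation_apply {K : Type*} [Field K] (v : Valuation K ℤᵐ⁰) {x : K}
    (hx : x ≠ 0) : v.toRealAddValuation x = (((-(WithZero.log (v x)) : ℤ) : ℝ) : WithTop ℝ) :=
  if_neg hx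

/-- A one-dimensional noetherian local domain is dominated by a valuation with values in `ℤ`. -/
lemma exists_valuation_of_krullDimLE_one {K : Type*} [Field K] (A : LocalSubring K)
    [IsNoetherianRing A.toSubring] [Ring.KrullDimLE 1 A.toSubring]
    [IsFractionRing A.toSubring K] :
    ∃ v : Valuation K ℤᵐ⁰, ∀ a : A.toSubring, v a ≤ 1 ∧
      (a ∈ IsLocalRing.maximalIdeal A.toSubring → v a < 1) := by
  classical
  obtain ⟨B, hAB, hloc⟩ := A.exists_le_valuationSubring
  let i : A.toSubring →+* B := Subring.inclusion hAB
  have hi : ∀ a ∈ IsLocalRing.maximalIdeal A.toSubring, i a ∈ IsLocalRing.maximalIdeal B :=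
    fun a ha hu => ha (hloc.1 a hu)
  let : Algebra A.toSubring B := i.toAlgebra
  have : FaithfulSMul A.toSubring B :=
    (faithfulSMul_iff_algebraMap_injective _ _).2 (Subring.inclusion_injective hAB)
  have hfr : IsFractionExtension A.toSubring B := by
    intro b
    obtain ⟨t, s, hs, hts⟩ := IsFractionRing.div_surjective (A := A.toSubring) (b : K)
    have hs0 := nonZeroDivisors.ne_zero hs
    refine ⟨s, t, hs0, Subtype.ext ?_⟩
    rw [div_eq_iff (by simpa using hs0)] at hts
    rw [Algebra.smul_def]
    show (s : K) * b = t
    rw [mul_comm]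
    exact hts.symm
  have : IsNoetherianRing B := hfr.isNoetherianRing
  -- A Noetherian valuation ring is a field or a discrete valuation ring. In the first case
  -- domination forces the maximal ideal of `A` to vanish, and the trivial valuation works.
  by_cases hB : IsField B
  · refine ⟨1, fun a => ?_⟩
    have h1 : ∀ x : K, (1 : Valuation K ℤᵐ⁰) x ≤ 1 := Valuation.one_apply_le_one
    refine ⟨h1 _, fun ha => ?_⟩
    have h0 : i a = 0 := by
      by_contra h
      obtain ⟨c, hc⟩ := hB.mul_inv_cancel h
      exact hi a ha (IsUnit.of_mul_eq_one _ hc)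
    have h0' : (a : K) = 0 := congrArg Subtype.val h0
    rw [h0', map_zero]
    exact zero_lt_one
  · have h01 : IsDiscreteValuationRing B ↔ ValuationRing B :=
      (IsDiscreteValuationRing.TFAE B hB).out 0 1
    have : IsDiscreteValuationRing B := h01.2 inferInstance
    let P : IsDedekindDomain.HeightOneSpectrum B := IsDiscreteValuationRing.maximalIdeal B
    refine ⟨P.valuation K, fun a => ⟨P.valuation_le_one (K := K) (i a), fun ha => ?_⟩⟩
    exact (P.valuation_lt_one_iff_mem (K := K) (i a)).2 (hi a ha)

/-- A noetherian local domain is dominated by a valuation with values in `ℤ`. -/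
lemma IsLocalRing.exists_valuation_int (R K : Type*) [CommRing R] [IsDomain R]
    [IsNoetherianRing R] [IsLocalRing R] [Field K] [Algebra R K] [IsFractionRing R K] :
    ∃ v : Valuation K ℤᵐ⁰, ∀ a : R, v (algebraMap R K a) ≤ 1 ∧
      (a ∈ IsLocalRing.maximalIdeal R → v (algebraMap R K a) < 1) := by
  classical
  have hinj : Function.Injective (algebraMap R K) := IsFractionRing.injective R K
  -- The auxiliary valuation ring `W` need not be discrete. It selects a chart of the blowup of the
  -- maximal ideal and shows that the exceptional divisor meets this chart.
  obtain ⟨W, hRW, hWloc⟩ := (LocalSubring.range (algebraMap R K)).exists_le_valuationSubring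
  have hW : ∀ r : R, algebraMap R K r ∈ W := fun r => hRW ⟨r, rfl⟩
  have hWm : ∀ r ∈ IsLocalRing.maximalIdeal R, (algebraMap R K r)⁻¹ ∈ W →
      algebraMap R K r = 0 := by
    intro r hr hri
    by_contra h0
    have hu : IsUnit (Subring.inclusion hRW ⟨algebraMap R K r, ⟨r, rfl⟩⟩) :=
      IsUnit.of_mul_eq_one ⟨_, hri⟩ (Subtype.ext (mul_inv_cancel₀ h0))
    obtain ⟨⟨_, s, rfl⟩, hs⟩ := isUnit_iff_exists_inv.1 (hWloc.1 _ hu)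
    refine hr (IsUnit.of_mul_eq_one s (hinj ?_))
    rw [map_mul, map_one]
    exact congrArg Subtype.val hs
  by_cases hm : IsLocalRing.maximalIdeal R = ⊥
  · refine ⟨1, fun a => ⟨Valuation.one_apply_le_one _, fun ha => ?_⟩⟩
    rw [hm, Ideal.mem_bot] at ha
    simp [ha]
  obtain ⟨s, hs⟩ := (isNoetherianRing_iff_ideal_fg R).1 inferInstance (IsLocalRing.maximalIdeal R)
  have hsne : s.Nonempty := by
    rw [Finset.nonempty_iff_ne_empty]
    rintro rfl
    exact hm (by rw [← hs]; simp)
  -- The valuation of `W` is multiplicative, so a generator of largest value divides all the others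
  -- in `W`. In the chart `S` below, the maximal ideal of `R` generates the principal ideal `aS`.
  obtain ⟨a, has, ha⟩ := s.exists_max_image (fun r => W.valuation (algebraMap R K r)) hsne
  have ham : a ∈ IsLocalRing.maximalIdeal R := hs ▸ Submodule.subset_span has
  have ha0 : algebraMap R K a ≠ 0 := by
    intro h0
    apply hm
    rw [← hs, Submodule.span_eq_bot]
    intro r hr
    have := ha r hr
    rw [h0, map_zero, le_zero_iff, map_eq_zero] at this
    exact hinj (by rw [this, map_zero])
  let t : Finset K := s.image fun r => algebraMap R K r / algebraMap R K a
  let S : Subalgebra R K := Algebra.adjoin R (t : Set K)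
  have hSW : ∀ x ∈ S, x ∈ W := by
    intro x hx
    induction hx using Algebra.adjoin_induction with
    | mem x hx =>
      obtain ⟨r, hr, rfl⟩ := Finset.mem_image.1 (Finset.mem_coe.1 hx)
      rw [← W.valuation_le_one_iff, map_div₀]
      exact div_le_one_of_le₀ (ha r hr) zero_le
    | algebraMap r => exact hW r
    | add x y _ _ hx hy => exact W.add_mem _ _ hx hy
    | mul x y _ _ hx hy => exact W.mul_mem _ _ hx hy
  have : Algebra.FiniteType R S := (Subalgebra.fg_iff_finiteType S).1 ⟨t, rfl⟩
  let A : Subring K := S.toSubring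
  have : IsNoetherianRing A := Algebra.FiniteType.isNoetherianRing R S
  let j : R →+* A := algebraMap R S
  have hI : Ideal.span {j a} ≠ ⊤ := by
    rw [Ne, Ideal.span_singleton_eq_top]
    intro hu
    obtain ⟨c, hc⟩ := hu.exists_right_inv
    have hc' : algebraMap R K a * (c : K) = 1 := congrArg Subtype.val hc
    exact ha0 (hWm a ham (by rw [← eq_inv_of_mul_eq_one_right hc']; exact hSW _ c.2))
  -- By Krull's principal ideal theorem `P` has height at most one, so the localization at `P` falls
  -- under the one-dimensional case; it dominates `R` because `P` contains `a`.
  obtain ⟨P, hP⟩ := Ideal.nonempty_minimalPrimes hI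
  have hPp : P.IsPrime := hP.1.1
  have hmP : ∀ r ∈ IsLocalRing.maximalIdeal R, j r ∈ P := by
    intro r hr
    have haP : j a ∈ P := hP.1.2 (Ideal.mem_span_singleton_self _)
    rw [← hs] at hr
    have hle : Submodule.span R (s : Set R) ≤ P.comap j := by
      refine Submodule.span_le.2 fun r hr => ?_
      have hrS : algebraMap R K r / algebraMap R K a ∈ A :=
        Algebra.subset_adjoin (Finset.mem_coe.2 (Finset.mem_image_of_mem _ hr))
      have : j r = ⟨_, hrS⟩ * j a := Subtype.ext (div_mul_cancel₀ _ ha0).symm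
      show j r ∈ P
      rw [this]
      exact P.mul_mem_left _ haP
    exact hle hr
  let T : LocalSubring K := LocalSubring.ofPrime A P
  have : IsNoetherianRing T.toSubring := IsLocalization.isNoetherianRing P.primeCompl _ inferInstance
  have : Ring.KrullDimLE 1 T.toSubring := by
    rw [Ring.krullDimLE_iff, IsLocalization.AtPrime.ringKrullDim_eq_height P]
    have := Ideal.height_le_one_of_isPrincipal_of_mem_minimalPrimes (Ideal.span {j a}) P hP
    exact_mod_cast this
  have hAT : A ≤ T.toSubring := LocalSubring.le_ofPrime A P
  have : IsFractionRing T.toSubring K := by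
    refine IsFractionRing.of_field _ _ fun z => ?_
    obtain ⟨x, y, -, hxy⟩ := IsFractionRing.div_surjective (A := R) z
    exact ⟨⟨_, hAT (j x).2⟩, ⟨_, hAT (j y).2⟩, hxy.symm⟩
  obtain ⟨v, hv⟩ := exists_valuation_of_krullDimLE_one T
  refine ⟨v, fun r => ⟨(hv ⟨_, hAT (j r).2⟩).1, fun hr => (hv ⟨_, hAT (j r).2⟩).2 ?_⟩⟩
  exact (IsLocalization.AtPrime.to_map_mem_maximal_iff T.toSubring P (j r)).2 (hmP r hr)

/-- A noetherian local domain is dominated by a real valuation with values in `ℤ`. -/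
lemma IsLocalRing.exists_addValuation_int (R K : Type*) [CommRing R] [IsDomain R]
    [IsNoetherianRing R] [IsLocalRing R] [Field K] [Algebra R K] [IsFractionRing R K] :
    ∃ v : AddValuation K (WithTop ℝ), (∀ a, a ≠ 0 → ∃ n : ℤ, v a = ((n : ℝ) : WithTop ℝ)) ∧
      ∀ a : R, 0 ≤ v (algebraMap R K a) ∧
        (a ∈ IsLocalRing.maximalIdeal R → 0 < v (algebraMap R K a)) := by
  obtain ⟨v, hv⟩ := IsLocalRing.exists_valuation_int R K
  refine ⟨v.toRealAddValuation, fun a ha => ⟨_, v.toRealAddValuation_apply ha⟩, fun a => ?_⟩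
  by_cases ha : algebraMap R K a = 0
  · simp [ha]
  have hva := v.ne_zero_iff.2 ha
  have h1 := hv a
  rw [← WithZero.log_le_log hva one_ne_zero, ← WithZero.log_lt_log hva one_ne_zero,
    WithZero.log_one] at h1
  rw [v.toRealAddValuation_apply ha, ← WithTop.coe_zero, WithTop.coe_le_coe, WithTop.coe_lt_coe,
    ← Int.cast_zero, Int.cast_le, Int.cast_lt]
  exact ⟨by omega, fun h => by have := h1.2 h; omega⟩

/-! ### Extended real values, and valuations on rings. -/

namespace BethMLD

lemma toEReal_injective : Function.Injective toEReal := WithBot.coe_injective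

lemma toEReal_le {a b : WithTop ℝ} : toEReal a ≤ toEReal b ↔ a ≤ b := WithBot.coe_le_coe

lemma toEReal_lt {a b : WithTop ℝ} : toEReal a < toEReal b ↔ a < b := WithBot.coe_lt_coe

@[simp] lemma toEReal_zero : toEReal 0 = 0 := rfl

@[simp] lemma toEReal_top : toEReal ⊤ = ⊤ := rfl

@[simp] lemma toEReal_coe (r : ℝ) : toEReal (r : WithTop ℝ) = (r : EReal) := rfl

lemma toEReal_add (a b : WithTop ℝ) : toEReal (a + b) = toEReal a + toEReal b := rfl

lemma exists_toEReal_eq {a : EReal} (ha : a ≠ ⊥) : ∃ b, toEReal b = a :=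
  WithBot.ne_bot_iff_exists.1 ha

/-- Elements outside the support have finite value, so `w` extends to the localization; there the
maximal ideal has value `∞`, so `w` descends to the residue field. -/
lemma _root_.AddValuation.exists_residueField {R A : Type*} [CommRing R] [CommRing A]
    [IsLocalRing A] [Algebra R A] (w : AddValuation R (WithTop ℝ)) (P : Ideal R) [P.IsPrime]
    [IsLocalization.AtPrime A P] (hP : P = w.supp) :
    ∃ v : AddValuation (IsLocalRing.ResidueField A) (WithTop ℝ),
      ∀ f, v (IsLocalRing.residue A (algebraMap R A f)) = w f := by
  let w' : Valuation R (Multiplicative (WithTop ℝ)ᵒᵈ) := AddValuation.toValuation w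
  have hS : P.primeCompl ≤ w'.supp.primeCompl := fun s hs h => hs (by rw [hP]; exact h)
  let v := w'.extendToLocalization hS A
  have hv : ∀ f, v (algebraMap R A f) = w' f := w'.extendToLocalization_apply_map_apply hS A
  have hm : IsLocalRing.maximalIdeal A ≤ v.supp := by
    intro a ha
    obtain ⟨⟨f, s⟩, hfs⟩ := IsLocalization.surj P.primeCompl a
    have hf : f ∈ P := by
      rw [← IsLocalization.AtPrime.to_map_mem_maximal_iff A P f, ← hfs]
      exact Ideal.mul_mem_right _ _ ha
    have h0 : v a * v (algebraMap R A s) = 0 := by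
      rw [← map_mul, hfs, hv]
      rw [hP] at hf
      exact hf
    refine (mul_eq_zero.1 h0).resolve_right fun h => s.2 ?_
    rw [hv] at h
    exact hP.ge (show (s : R) ∈ w.supp from h)
  exact ⟨AddValuation.ofValuation (v.onQuot hm), fun f => hv f⟩

lemma _root_.AddValuation.isPrime_supp {R : Type*} [CommRing R] (w : AddValuation R (WithTop ℝ)) :
    w.supp.IsPrime :=
  inferInstanceAs (AddValuation.toValuation w).supp.IsPrime

lemma _root_.AddValuation.exists_isPrime_pos {R : Type*} [CommRing R]
    (w : AddValuation R (WithTop ℝ)) (hw : ∀ f, 0 ≤ w f) :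
    ∃ P : Ideal R, P.IsPrime ∧ ∀ f, f ∈ P ↔ 0 < w f := by
  let P : Ideal R :=
    { carrier := {f | 0 < w f}
      zero_mem' := by simp
      add_mem' := fun {f g} hf hg => (lt_min hf hg).trans_le (w.map_add f g)
      smul_mem' := fun f g hg => by
        rw [Set.mem_ofPred_eq, smul_eq_mul, w.map_mul]
        exact lt_of_lt_of_le hg (le_add_of_nonneg_left (hw f)) }
  refine ⟨P, ⟨fun h => ?_, fun {f g} hfg => ?_⟩, fun f => Iff.rfl⟩
  · have : (1 : R) ∈ P := h ▸ trivial
    simp [P] at this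
  · by_contra! h
    have h1 : w f = 0 := le_antisymm (not_lt.1 h.1) (hw f)
    have h2 : w g = 0 := le_antisymm (not_lt.1 h.2) (hw g)
    have : 0 < w (f * g) := hfg
    simp [h1, h2] at this

/-! ### Semivaluations on an affine open as valuations on its ring of sections. -/

variable {X : Scheme.{u}} {V : X.Opens}

lemma exists_mul_germ_eq (hV : IsAffineOpen V) {z : X} (hz : z ∈ V) (a : X.presheaf.stalk z) :
    ∃ f s : Γ(X, V), z ∈ X.basicOpen s ∧
      a * X.presheaf.germ V z hz s = X.presheaf.germ V z hz f := by
  let := X.presheaf.algebra_section_stalk ⟨z, hz⟩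
  have := hV.isLocalization_stalk ⟨z, hz⟩
  obtain ⟨⟨f, s⟩, hfs⟩ := IsLocalization.surj (hV.primeIdealOf ⟨z, hz⟩).asIdeal.primeCompl a
  exact ⟨f, s, (X.mem_basicOpen _ z hz).2 (IsLocalization.map_units (X.presheaf.stalk z) s), hfs⟩

lemma mem_basicOpen_of_primeIdealOf (hV : IsAffineOpen V) {z : X} (hz : z ∈ V) (f : Γ(X, V)) :
    z ∈ X.basicOpen f ↔ f ∉ (hV.primeIdealOf ⟨z, hz⟩).asIdeal := by
  let := X.presheaf.algebra_section_stalk ⟨z, hz⟩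
  have := hV.isLocalization_stalk ⟨z, hz⟩
  rw [X.mem_basicOpen _ z hz]
  exact IsLocalization.AtPrime.isUnit_to_map_iff (X.presheaf.stalk z) _ f

lemma exists_point (hV : IsAffineOpen V) (P : Ideal Γ(X, V)) [hP : P.IsPrime] :
    ∃ z : X, ∃ hz : z ∈ V, hV.primeIdealOf ⟨z, hz⟩ = ⟨P, hP⟩ := by
  let q : Spec Γ(X, V) := ⟨P, hP⟩
  have hq : hV.fromSpec q ∈ V := by
    rw [← SetLike.mem_coe, ← hV.range_fromSpec]
    exact ⟨q, rfl⟩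
  exact ⟨hV.fromSpec q, hq, hV.fromSpec.isOpenEmbedding.injective (hV.fromSpec_primeIdealOf ⟨_, hq⟩)⟩

lemma specializes_of_basicOpen (hV : IsAffineOpen V) {y z : X} (hz : z ∈ V)
    (h : ∀ f : Γ(X, V), z ∈ X.basicOpen f → y ∈ X.basicOpen f) : y ⤳ z := by
  rw [specializes_iff_forall_open]
  intro W hW hzW
  obtain ⟨f, hf, hzf⟩ := hV.exists_basicOpen_le ⟨z, (⟨hzW, hz⟩ : z ∈ (⟨W, hW⟩ : X.Opens) ⊓ V).1⟩ hz
  exact hf (h f hzf)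

lemma stalkToResidueField_germ {y z : X} (h : y ⤳ z) (hz : z ∈ V) (f : Γ(X, V)) :
    stalkToResidueField h (X.presheaf.germ V z hz f) =
      X.evaluation V y (h.mem_open V.isOpen hz) f := by
  have := X.presheaf.germ_stalkSpecializes (U := V) hz h
  simp only [stalkToResidueField]
  rw [← X.germ_residue, ← this]
  rfl

lemma mem_bethOpen_of_isCenter {ζ : Semivaluation X} {z : X} (h : ζ.IsCenter z) (hz : z ∈ V) :
    ζ ∈ bethOpen V := ⟨z, hz, h.1, fun a => (h.2 a).1⟩

/-- The value of a semivaluation on `V` at a section over `V`. -/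
noncomputable def secVal (ζ : bethOpen V) (f : Γ(X, V)) : WithTop ℝ :=
  ζ.1.val (X.evaluation V ζ.1.home (home_mem_of_mem_bethOpen ζ.2) f)

lemma ev_eq (ζ : bethOpen V) (f : Γ(X, V)) : ev V f ζ = toEReal (secVal ζ f) := rfl

@[simp] lemma secVal_zero (ζ : bethOpen V) : secVal ζ 0 = ⊤ := by simp [secVal]

@[simp] lemma secVal_one (ζ : bethOpen V) : secVal ζ 1 = 0 := by simp [secVal]

@[simp] lemma secVal_mul (ζ : bethOpen V) (f g : Γ(X, V)) :
    secVal ζ (f * g) = secVal ζ f + secVal ζ g := by simp [secVal]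

lemma secVal_add (ζ : bethOpen V) (f g : Γ(X, V)) :
    min (secVal ζ f) (secVal ζ g) ≤ secVal ζ (f + g) := by
  simp only [secVal, map_add]
  exact ζ.1.val.map_add _ _

lemma secVal_nonneg (ζ : bethOpen V) (f : Γ(X, V)) : 0 ≤ secVal ζ f := by
  obtain ⟨z, hz, h, h0⟩ := ζ.2
  have := h0 (X.presheaf.germ V z hz f)
  rwa [stalkToResidueField_germ h hz] at this

lemma secVal_eq_top_iff (ζ : bethOpen V) (f : Γ(X, V)) :
    secVal ζ f = ⊤ ↔ ζ.1.home ∉ X.basicOpen f := by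
  rw [secVal, AddValuation.top_iff, X.evaluation_eq_zero_iff_notMem_basicOpen]

/-- A germ at `z` is a fraction `f/s` with `s` invertible at `z`. If sections invertible at `z` have
value `0`, the germ has the value of `f`, so sections suffice to detect the center. -/
lemma isCenter_iff (hV : IsAffineOpen V) (ζ : bethOpen V) {z : X} (hz : z ∈ V) :
    ζ.1.IsCenter z ↔ ∀ f : Γ(X, V), 0 < secVal ζ f ↔ z ∉ X.basicOpen f := by
  constructor
  · rintro ⟨h, h0⟩ f
    have h1 : stalkToResidueField h (X.presheaf.germ V z hz f) =
      X.evaluation V ζ.1.home (home_mem_of_mem_bethOpen ζ.2) f := stalkToResidueField_germ h hz f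
    rw [X.mem_basicOpen _ z hz]
    constructor
    · intro hf hu
      obtain ⟨b, hb⟩ := hu.exists_right_inv
      have hb0 := (h0 b).1
      have h2 := congrArg (fun a => ζ.1.val (stalkToResidueField h a)) hb
      simp only [map_mul, h1, map_one, AddValuation.map_mul, AddValuation.map_one] at h2
      exact (add_pos_of_pos_of_nonneg hf hb0).ne' h2
    · intro hu
      have := (h0 (X.presheaf.germ V z hz f)).2 ((IsLocalRing.mem_maximalIdeal _).2 hu)
      rwa [h1] at this
  · intro h0
    have hs : ζ.1.home ⤳ z := by
      refine specializes_of_basicOpen hV hz fun f hf => ?_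
      by_contra hy
      rw [← secVal_eq_top_iff] at hy
      refine (h0 f).1 ?_ hf
      rw [hy]; exact WithTop.coe_lt_top 0
    refine ⟨hs, fun a => ?_⟩
    obtain ⟨f, s, hs', hfs⟩ := exists_mul_germ_eq hV hz a
    have h1 := congrArg (fun a => ζ.1.val (stalkToResidueField hs a)) hfs
    simp only [map_mul, stalkToResidueField_germ, AddValuation.map_mul] at h1
    have h2 : secVal ζ s = 0 :=
      le_antisymm (not_lt.1 fun h => (h0 s).1 h hs') (secVal_nonneg ζ s)
    have h3 : ζ.1.val (stalkToResidueField hs a) = secVal ζ f := by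
      have : ζ.1.val (stalkToResidueField hs a) + secVal ζ s = secVal ζ f := h1
      rwa [h2, add_zero] at this
    rw [h3]
    refine ⟨secVal_nonneg ζ f, fun ha => (h0 f).2 ?_⟩
    rw [X.mem_basicOpen _ z hz, ← hfs]
    exact (IsLocalRing.mem_maximalIdeal _).1 (Ideal.mul_mem_right _ _ ha)

lemma exists_isCenter (hV : IsAffineOpen V) (ζ : bethOpen V) : ∃ z ∈ V, ζ.1.IsCenter z := by
  obtain ⟨P, hP, hPw⟩ := (ζ.1.val.comap (X.evaluation V ζ.1.home
    (home_mem_of_mem_bethOpen ζ.2)).hom).exists_isPrime_pos (secVal_nonneg ζ)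
  obtain ⟨z, hz, hzP⟩ := exists_point hV P
  refine ⟨z, hz, (isCenter_iff hV ζ hz).2 fun f => ?_⟩
  rw [mem_basicOpen_of_primeIdealOf hV hz, hzP, not_not]
  exact (hPw f).symm

/-- The home is the point of the support of `w`; the center is the point of the prime where `w > 0`.
This realizes limits of semivaluations. -/
lemma exists_semivaluation (hV : IsAffineOpen V) (w : AddValuation Γ(X, V) (WithTop ℝ))
    (hw : ∀ f, 0 ≤ w f) : ∃ ζ : bethOpen V, ∀ f, secVal ζ f = w f := by
  have := w.isPrime_supp
  obtain ⟨y, hy, hyP⟩ := exists_point hV w.supp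
  let := X.presheaf.algebra_section_stalk ⟨y, hy⟩
  have := hV.isLocalization_stalk ⟨y, hy⟩
  obtain ⟨v, hv'⟩ : ∃ v : AddValuation (X.residueField y) (WithTop ℝ),
      ∀ f, v (X.evaluation V y hy f) = w f :=
    w.exists_residueField (A := X.presheaf.stalk y)
      (hV.primeIdealOf ⟨y, hy⟩).asIdeal (by rw [hyP])
  obtain ⟨P, hP, hPw⟩ := w.exists_isPrime_pos hw
  obtain ⟨z, hz, hzP⟩ := exists_point hV P
  have hbz : ∀ f, z ∈ X.basicOpen f ↔ w f = 0 := by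
    intro f
    rw [mem_basicOpen_of_primeIdealOf hV hz, hzP]
    rw [hPw]
    exact not_lt.trans ⟨fun h => le_antisymm h (hw f), fun h => h.le⟩
  have hs : y ⤳ z := by
    refine specializes_of_basicOpen hV hz fun f hf => ?_
    rw [hbz] at hf
    rw [mem_basicOpen_of_primeIdealOf hV hy, hyP]
    intro h
    have : w f = ⊤ := h
    simp [hf] at this
  have h0 : ∀ a, 0 ≤ v (stalkToResidueField hs a) := by
    intro a
    obtain ⟨f, s, hs', hfs⟩ := exists_mul_germ_eq hV hz a
    have h1 := congrArg (fun a => v (stalkToResidueField hs a)) hfs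
    simp only [map_mul, stalkToResidueField_germ, AddValuation.map_mul, hv'] at h1
    rw [(hbz s).1 hs', add_zero] at h1
    exact h1 ▸ hw f
  exact ⟨⟨⟨y, v, z, hs, h0⟩, z, hz, hs, h0⟩, hv'⟩

end BethMLD

/-! ### Compactness, and semicontinuity of the discrepancy terms. -/

namespace BethMLD

variable {X : Scheme.{u}} {V : X.Opens}

lemma continuous_ev (f : Γ(X, V)) : @Continuous _ _ (bethOpenTopology V) _ (ev V f) :=
  continuous_iInf_dom continuous_induced_dom

lemma continuous_bethOpen_val (hV : IsAffineOpen V) :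
    @Continuous _ _ (bethOpenTopology V) bethTopology
      (Subtype.val : bethOpen V → Semivaluation X) := by
  rw [continuous_iff_coinduced_le]
  exact le_iSup (fun U : X.affineOpens => TopologicalSpace.coinduced
    (Subtype.val : bethOpen U.1 → Semivaluation X) (bethOpenTopology U.1)) ⟨V, hV⟩

lemma ev_nonneg (f : Γ(X, V)) (ζ : bethOpen V) : 0 ≤ ev V f ζ := by
  rw [ev_eq, ← toEReal_zero, toEReal_le]
  exact secVal_nonneg ζ f

lemma _root_.EReal.tendsto_add_of_nonneg {α : Type*} {F : Filter α} {u v : α → EReal} {a b : EReal}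
    (hu : Filter.Tendsto u F (𝓝 a)) (hv : Filter.Tendsto v F (𝓝 b)) (ha : 0 ≤ a) (hb : 0 ≤ b) :
    Filter.Tendsto (fun x => u x + v x) F (𝓝 (a + b)) := by
  have h : ContinuousAt (fun x : EReal × EReal => x.1 + x.2) (a, b) :=
    EReal.continuousAt_add (.inr (ne_bot_of_le_ne_bot EReal.zero_ne_bot hb))
      (.inl (ne_bot_of_le_ne_bot EReal.zero_ne_bot ha))
  exact h.tendsto.comp (hu.prodMk_nhds hv)

/-- Along an ultrafilter all evaluations converge in `EReal`. The limits again form a valuation,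
since addition is continuous on nonnegative values. -/
lemma compactSpace_bethOpen (hV : IsAffineOpen V) :
    @CompactSpace (bethOpen V) (bethOpenTopology V) := by
  let := bethOpenTopology V
  refine ⟨isCompact_iff_ultrafilter_le_nhds.2 fun F _ => ?_⟩
  let g : Γ(X, V) → EReal := fun f => (F.map (ev V f)).lim
  have hg : ∀ f, Filter.Tendsto (ev V f) F (𝓝 (g f)) := fun f => (F.map (ev V f)).le_nhds_lim
  have hg0 : ∀ f, 0 ≤ g f := fun f => ge_of_tendsto' (hg f) (ev_nonneg f)
  choose w hw using fun f => exists_toEReal_eq (ne_bot_of_le_ne_bot EReal.zero_ne_bot (hg0 f))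
  let v : AddValuation Γ(X, V) (WithTop ℝ) := AddValuation.of w
    (toEReal_injective ((hw 0).trans (tendsto_nhds_unique (hg 0)
      (tendsto_const_nhds.congr fun ζ => by simp [ev_eq]))))
    (toEReal_injective ((hw 1).trans (tendsto_nhds_unique (hg 1)
      (tendsto_const_nhds.congr fun ζ => by simp [ev_eq]))))
    (fun f h => by
      rw [min_le_iff, ← toEReal_le, ← toEReal_le, hw, hw, hw, ← min_le_iff]
      refine le_of_tendsto_of_tendsto' ((hg f).min (hg h)) (hg (f + h)) fun ζ => ?_
      simp only [ev_eq, min_le_iff, toEReal_le]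
      exact min_le_iff.1 (secVal_add ζ f h))
    (fun f h => toEReal_injective (by
      rw [toEReal_add, hw, hw, hw]
      refine tendsto_nhds_unique (hg (f * h)) ((EReal.tendsto_add_of_nonneg (hg f) (hg h) (hg0 f)
        (hg0 h)).congr fun ζ => ?_)
      simp [ev_eq, toEReal_add]))
  obtain ⟨ζ, hζ⟩ := exists_semivaluation hV v fun f => by
    rw [← toEReal_le]
    show toEReal 0 ≤ toEReal (w f)
    rw [hw f]
    exact hg0 f
  refine ⟨ζ, trivial, ?_⟩
  rw [nhds_iInf, le_iInf_iff]
  intro f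
  rw [@nhds_induced _ _ _ (ev V f), ← Filter.map_le_iff_le_comap, ev_eq, hζ]
  show Filter.Tendsto _ _ (𝓝 (toEReal (w f)))
  rw [hw]
  exact hg f

lemma tendsto_sub_coe_mul {α : Type*} {F : Filter α} {u v : α → EReal} {a b : EReal}
    (hu : Filter.Tendsto u F (𝓝 a)) (hv : Filter.Tendsto v F (𝓝 b)) (c : ℝ)
    (hb0 : b ≠ ⊥) (hb : b ≠ ⊤) :
    Filter.Tendsto (fun x => u x - (c : EReal) * v x) F (𝓝 (a - (c : EReal) * b)) := by
  lift b to ℝ using ⟨hb, hb0⟩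
  have h1 : Filter.Tendsto (fun x => -((c : EReal) * v x)) F (𝓝 (-((c : EReal) * b))) :=
    (continuous_neg.tendsto _).comp
      ((EReal.continuousAt_mul (p := ((c : EReal), (b : EReal))) (.inr (EReal.coe_ne_bot _))
        (.inr (EReal.coe_ne_top _)) (.inl (EReal.coe_ne_bot _))
        (.inl (EReal.coe_ne_top _))).tendsto.comp (tendsto_const_nhds.prodMk_nhds hv))
  have h : ContinuousAt (fun x : EReal × EReal => x.1 + x.2) (a, -((c : EReal) * b)) :=
    EReal.continuousAt_add
      (.inr (by rw [← EReal.coe_mul, ← EReal.coe_neg]; exact EReal.coe_ne_bot _))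
      (.inr (by rw [← EReal.coe_mul, ← EReal.coe_neg]; exact EReal.coe_ne_top _))
  exact h.tendsto.comp (hu.prodMk_nhds h1)

/-- The function `(a, b) ↦ (a - q * b) / (q - 1)`. -/
noncomputable def secTerm (q : ℝ) (a b : EReal) : EReal :=
  (a - (q : EReal) * b) / ((q - 1 : ℝ) : EReal)

/-- The convention `∞ - ∞ = -∞` matters here: terms with `ζ(ψ(f)) = ∞` never affect the supremum. -/
lemma secTerm_top {q : ℝ} (hq : 1 < q) (a : EReal) : secTerm q a ⊤ = ⊥ := by
  rw [secTerm, EReal.coe_mul_top_of_pos (by linarith), EReal.sub_top,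
    EReal.bot_div_of_pos_ne_top (by exact_mod_cast sub_pos.2 hq) (EReal.coe_ne_top _)]

lemma top_secTerm {q : ℝ} (hq : 1 < q) (b : ℝ) : secTerm q ⊤ b = ⊤ := by
  rw [secTerm, ← EReal.coe_mul, EReal.top_sub_coe,
    EReal.top_div_of_pos_ne_top (by exact_mod_cast sub_pos.2 hq) (EReal.coe_ne_top _)]

/-- At points where `v = ∞` the value is `-∞` and nothing is to be shown; where `v` is finite, the
term is continuous even if `u = ∞`. -/
lemma lowerSemicontinuous_secTerm {α : Type*} [TopologicalSpace α] {q : ℝ} (hq : 1 < q)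
    {u v : α → EReal} (hu : Continuous u) (hv : Continuous v) (hv0 : ∀ x, 0 ≤ v x) :
    LowerSemicontinuous fun x => secTerm q (u x) (v x) := by
  intro x y (hy : y < secTerm q (u x) (v x))
  have hq' : (0 : EReal) < ((q - 1 : ℝ) : EReal) := by exact_mod_cast sub_pos.2 hq
  have hlt : ∀ x, y < secTerm q (u x) (v x) ↔
      y * ((q - 1 : ℝ) : EReal) < u x - (q : EReal) * v x := fun x =>
    EReal.lt_div_iff hq' (EReal.coe_ne_top _)
  have hb : v x ≠ ⊤ := by
    intro h
    rw [h, secTerm_top hq] at hy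
    exact not_lt_bot hy
  simp only [hlt] at hy ⊢
  exact (tendsto_sub_coe_mul (hu.tendsto x) (hv.tendsto x) q
    (ne_bot_of_le_ne_bot EReal.zero_ne_bot (hv0 x)) hb).eventually_const_lt hy

end BethMLD

/-! ### Uniqueness of centers, and germs of Cartier subalgebras. -/

namespace BethMLD

variable {X : Scheme.{u}} {V : X.Opens}

lemma stalkToResidueField_eq {y z : X} (h : y ⤳ z) (a : X.presheaf.stalk z) :
    stalkToResidueField h a = X.residue y (X.presheaf.stalkSpecializes h a) := rfl

lemma algebraMap_stalkSpecializes [IsIntegral X] {y z : X} (h : y ⤳ z) (a : X.presheaf.stalk z) :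
    algebraMap (X.presheaf.stalk y) X.functionField (X.presheaf.stalkSpecializes h a) =
      algebraMap (X.presheaf.stalk z) X.functionField a := by
  have := X.presheaf.stalkSpecializes_comp ((genericPoint_spec X).specializes (trivial : y ∈ ⊤)) h
  exact ConcreteCategory.congr_hom this a

lemma SpecMap_comp_SpecMap_comp_fromSpecStalk {y z : X} (h : y ⤳ z) {R : CommRingCat.{u}}
    (α : X.presheaf.stalk z ⟶ R) (β : R ⟶ X.residueField y)
    (hαβ : α ≫ β = X.presheaf.stalkSpecializes h ≫ X.residue y) :
    Spec.map β ≫ Spec.map α ≫ X.fromSpecStalk z = X.fromSpecResidueField y := by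
  rw [← Category.assoc, ← Spec.map_comp, hαβ, Spec.map_comp, Category.assoc,
    Scheme.SpecMap_stalkSpecializes_fromSpecStalk]
  rfl

lemma SpecMap_comp_fromSpecStalk_closedPoint {z : X} {R : CommRingCat.{u}} [IsLocalRing R]
    (α : X.presheaf.stalk z ⟶ R) [IsLocalHom α.hom] :
    (Spec.map α ≫ X.fromSpecStalk z) (IsLocalRing.closedPoint R) = z :=
  (Scheme.Hom.comp_apply _ _ _).trans
    ((congrArg (X.fromSpecStalk z) Spec_closedPoint).trans Scheme.fromSpecStalk_closedPoint)

/-- Uniqueness of the center of a semivaluation. -/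
lemma Semivaluation.IsCenter.unique [X.IsSeparated] {ζ : Semivaluation X} {z z' : X}
    (h : ζ.IsCenter z) (h' : ζ.IsCenter z') : z = z' := by
  -- This is the valuative criterion: each center is the image of the closed point under an
  -- extension of `Spec κ(home) ⟶ X` to `Spec B`. Two extensions agree, as they agree on a dense
  -- point of a reduced scheme and `X` is separated.
  let B := (AddValuation.toValuation ζ.val).valuationSubring
  have hB : ∀ k, k ∈ B ↔ 0 ≤ ζ.val k := fun _ => Iff.rfl
  let ι : Spec (X.residueField ζ.home) ⟶ Spec (.of B) := Spec.map (CommRingCat.ofHom B.subtype)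
  have : IsDominant ι := by
    refine ⟨?_⟩
    refine PrimeSpectrum.denseRange_comap_iff_ker_le_nilRadical _ |>.2 ?_
    have : RingHom.ker B.subtype = ⊥ := (RingHom.injective_iff_ker_eq_bot _).1 Subtype.val_injective
    exact this.le.trans bot_le
  have key : ∀ z, ζ.IsCenter z → ∃ g : Spec (.of B) ⟶ X,
      ι ≫ g = X.fromSpecResidueField ζ.home ∧ g (IsLocalRing.closedPoint B) = z := by
    rintro z ⟨hs, hz⟩
    let α : X.presheaf.stalk z →+* B :=
      (stalkToResidueField hs).codRestrict B.toSubring fun a => (hB _).2 (hz a).1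
    have hα : IsLocalHom α := by
      refine ⟨fun a ha => ?_⟩
      by_contra hu
      obtain ⟨b, hb⟩ := ha.exists_right_inv
      have h1 := (hz a).2 hu
      have h2 : 0 ≤ ζ.val b := (hB _).1 b.2
      have h3 : stalkToResidueField hs a * b = 1 := congrArg Subtype.val hb
      have h4 := congrArg ζ.val h3
      rw [AddValuation.map_mul, AddValuation.map_one] at h4
      exact (h1.trans_le (le_add_of_nonneg_right h2)).ne' h4
    refine ⟨Spec.map (CommRingCat.ofHom α) ≫ X.fromSpecStalk z, ?_, ?_⟩
    · exact SpecMap_comp_SpecMap_comp_fromSpecStalk hs _ _ rfl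
    · have hα' : IsLocalHom (CommRingCat.ofHom α).hom := hα
      exact SpecMap_comp_fromSpecStalk_closedPoint (R := .of B) (CommRingCat.ofHom α)
  obtain ⟨g, hg, hgz⟩ := key z h
  obtain ⟨g', hg', hgz'⟩ := key z' h'
  have : g = g' := ext_of_isDominant ι (hg.trans hg'.symm)
  rw [← hgz, ← hgz', this]

variable [IsIntegral X] {p : ℕ} {D : CartierSubalgebra p X}

lemma CartierSubalgebra.stalk_mono {e : ℕ} {y z : X} (h : y ⤳ z) : D.stalk e z ⊆ D.stalk e y := by
  rintro ψ ⟨U, hU, hz, hψ⟩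
  exact ⟨U, hU, h.mem_open U.isOpen hz, hψ⟩

lemma CartierSubalgebra.isPInvLinear_of_mem_stalk {e : ℕ} {z : X}
    {ψ : X.functionField →+ X.functionField} (hψ : ψ ∈ D.stalk e z) : IsPInvLinear p e ψ := by
  obtain ⟨U, hU, -, hψ⟩ := hψ
  exact (D.le_cartier e U hψ).1

lemma CartierSubalgebra.exists_stalk_eq {e : ℕ} {z : X}
    {ψ : X.functionField →+ X.functionField} (hψ : ψ ∈ D.stalk e z) (a : X.presheaf.stalk z) :
    ∃ b : X.presheaf.stalk z, algebraMap (X.presheaf.stalk z) X.functionField b =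
      ψ (algebraMap (X.presheaf.stalk z) X.functionField a) := by
  obtain ⟨U, hU, hz, hψ⟩ := hψ
  obtain ⟨W, hzW, f, rfl⟩ := X.presheaf.exists_germ_eq a
  let W' : X.Opens := U ⊓ W
  have hzW' : z ∈ W' := ⟨hz, hzW⟩
  have : Nonempty W' := ⟨⟨z, hzW'⟩⟩
  obtain ⟨b, hb⟩ := (D.le_cartier e U hψ).2 W' inf_le_left
    (X.presheaf.map (homOfLE inf_le_right).op f)
  refine ⟨X.presheaf.germ W' z hzW' b, ?_⟩
  rw [← X.presheaf.germ_res_apply (homOfLE (inf_le_right : W' ≤ W)) z hzW' f,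
    Scheme.algebraMap_germ_eq_germToFunctionField, Scheme.algebraMap_germ_eq_germToFunctionField]
  exact hb

/-- Quasi-coherence extends a germ at `z` to all of `V` at the cost of a factor `s` invertible at
`z`. When `z` is the center, `s` has value `0` and discrepancies do not change. -/
lemma CartierSubalgebra.exists_mulLeft_mem_sections (hV : IsAffineOpen V) [Nonempty V] {e : ℕ}
    {z : X} (hz : z ∈ V) {ψ : X.functionField →+ X.functionField} (hψ : ψ ∈ D.stalk e z) :
    ∃ s : Γ(X, V), z ∈ X.basicOpen s ∧
      (AddMonoidHom.mulLeft (X.germToFunctionField V s)).comp ψ ∈ D.sections e V := by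
  obtain ⟨U, hU, hzU, hψ⟩ := hψ
  obtain ⟨s, hs, hzs⟩ := hV.exists_basicOpen_le ⟨z, hzU⟩ hz
  have : Nonempty (X.basicOpen s) := ⟨⟨z, hzs⟩⟩
  obtain ⟨n, hn⟩ := D.quasiCoherent e V hV s ψ (D.restrict e U _ hs hψ)
  refine ⟨s ^ n, ?_, by rwa [map_pow]⟩
  rw [X.mem_basicOpen _ z hz, map_pow]
  exact ((X.mem_basicOpen _ z hz).1 hzs).pow n

lemma CartierSubalgebra.pow_mem_stalk {e : ℕ} {z : X} {ψ : AddMonoid.End X.functionField}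
    (hψ : ψ ∈ D.stalk e z) {n : ℕ} (hn : 1 ≤ n) : ψ ^ n ∈ D.stalk (n * e) z := by
  obtain ⟨U, hU, hz, hψ⟩ := hψ
  refine ⟨U, hU, hz, ?_⟩
  induction n, hn using Nat.le_induction with
  | base => simpa using hψ
  | succ n _ ih =>
    rw [Nat.succ_mul, pow_succ]
    exact D.comp_mem _ _ U _ _ ih hψ

lemma Induces.pow {y : X} {ψ : AddMonoid.End X.functionField}
    {φ : AddMonoid.End (X.residueField y)} (h : Induces y ψ φ) (n : ℕ) :
    Induces y (ψ ^ n : AddMonoid.End _) (φ ^ n : AddMonoid.End _) := by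
  induction n with
  | zero => exact fun a => ⟨a, rfl, rfl⟩
  | succ n ih =>
    intro a
    obtain ⟨b, hb, hb'⟩ := h a
    obtain ⟨c, hc, hc'⟩ := ih b
    refine ⟨c, ?_, ?_⟩
    · rw [hc, hb]; rfl
    · rw [← hc', ← hb']; rfl

/-- A map on the local ring at `y` that preserves the maximal ideal induces a map on `κ(y)`. -/
lemma exists_induces {y : X} {ψ : X.functionField →+ X.functionField}
    (h1 : ∀ a : X.presheaf.stalk y, ∃ b : X.presheaf.stalk y,
      algebraMap (X.presheaf.stalk y) X.functionField b =
        ψ (algebraMap (X.presheaf.stalk y) X.functionField a))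
    (h2 : ∀ a b : X.presheaf.stalk y, algebraMap (X.presheaf.stalk y) X.functionField b =
        ψ (algebraMap (X.presheaf.stalk y) X.functionField a) → X.residue y a = 0 →
          X.residue y b = 0) : ∃ φ, Induces y ψ φ := by
  choose F hF using h1
  have hsurj : ∀ k : X.residueField y, ∃ a, X.residue y a = k := X.residue_surjective y
  choose G hG using hsurj
  have key : ∀ a b, X.residue y (F (G (X.residue y a + X.residue y b))) =
      X.residue y (F a) + X.residue y (F b) := by
    intro a b
    rw [← sub_eq_zero, ← map_add (X.residue y).hom (F a), ← map_sub]
    refine h2 (G (X.residue y a + X.residue y b) - (a + b)) _ ?_ ?_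
    · simp only [map_sub, map_add, hF]
    · simp only [map_sub, map_add, hG, sub_self]
  have key' : ∀ a, X.residue y (F (G (X.residue y a))) = X.residue y (F a) := by
    intro a
    rw [← sub_eq_zero, ← map_sub]
    refine h2 (G (X.residue y a) - a) _ ?_ ?_
    · simp only [map_sub, hF]
    · simp only [map_sub, hG, sub_self]
  refine ⟨AddMonoidHom.mk' (fun k => X.residue y (F (G k))) fun k l => ?_, fun a => ⟨F a, hF a, key' a⟩⟩
  rw [← key (G k) (G l), hG, hG]

/-- Clearing denominators in `ψ(a) = c`. -/
lemma CartierSubalgebra.exists_sections (hV : IsAffineOpen V) [Nonempty V] (hp : 1 < p) {e : ℕ}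
    {y w : X} (h : y ⤳ w) (hw : w ∈ V) {ψ : X.functionField →+ X.functionField}
    (hψ : ψ ∈ D.stalk e w) {a c : X.presheaf.stalk y}
    (hac : algebraMap (X.presheaf.stalk y) X.functionField c =
      ψ (algebraMap (X.presheaf.stalk y) X.functionField a)) :
    ∃ (hy : y ∈ V) (s t f b : Γ(X, V)) (ψ' : X.functionField →+ X.functionField),
      w ∈ X.basicOpen s ∧ y ∈ X.basicOpen t ∧ ψ' ∈ D.sections e V ∧
      X.germToFunctionField V b = ψ' (X.germToFunctionField V f) ∧
      X.evaluation V y hy f = X.residue y a * X.evaluation V y hy t ^ p ^ e ∧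
      X.evaluation V y hy b = X.evaluation V y hy s * X.evaluation V y hy t * X.residue y c := by
  have hy := h.mem_open V.isOpen hw
  obtain ⟨s, hs, hsψ⟩ := D.exists_mulLeft_mem_sections hV hw hψ
  obtain ⟨f, t, ht, hft⟩ := exists_mul_germ_eq hV hy a
  -- Writing `a = f/t` as `f t ^ m / t ^ (p ^ e)` makes the denominator a `p ^ e`-th power, which
  -- `ψ` turns into `t`.
  obtain ⟨m, hm⟩ : ∃ m, p ^ e = m + 1 := ⟨p ^ e - 1, by have := Nat.pow_pos (n := e) (by omega : 0 < p); omega⟩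
  obtain ⟨b, hb⟩ := (D.le_cartier e V hsψ).2 V le_rfl (f * t ^ m)
  have hfa : X.presheaf.germ V y hy (f * t ^ m) = X.presheaf.germ V y hy t ^ p ^ e * a := by
    rw [map_mul, map_pow, ← hft, hm]
    ring
  have hbc : X.presheaf.germ V y hy b = X.presheaf.germ V y hy s * X.presheaf.germ V y hy t * c := by
    apply IsFractionRing.injective (X.presheaf.stalk y) X.functionField
    rw [Scheme.algebraMap_germ_eq_germToFunctionField, hb,
      ← Scheme.algebraMap_germ_eq_germToFunctionField (X := X) hy (f * t ^ m), hfa]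
    simp only [map_mul, map_pow, AddMonoidHom.comp_apply, AddMonoidHom.coe_mulLeft, hac,
      D.isPInvLinear_of_mem_stalk hψ _ _, Scheme.algebraMap_germ_eq_germToFunctionField]
    ring
  refine ⟨hy, s, t, f * t ^ m, b, _, hs, ht, hsψ, hb, ?_, ?_⟩
  · have := congrArg (X.residue y) hfa
    rw [map_mul _ (_ ^ _) a, map_pow] at this
    rw [mul_comm (X.residue y a)]
    exact this
  · have := congrArg (X.residue y) hbc
    rw [map_mul, map_mul] at this
    exact this

end BethMLD

/-! ### The log discrepancy over an affine open. -/

namespace BethMLD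

variable {X : Scheme.{u}} {V : X.Opens}

/-- Multiplying the argument of `ψ` by a `q`-th power multiplies its value by the `q`-th root; the
two contributions cancel. -/
lemma secTerm_cancel {q : ℝ} (hq : 1 < q) (a b : WithTop ℝ) (ha : a ≠ ⊤) (t : ℝ) :
    secTerm q (toEReal (a + (q * t : ℝ))) (toEReal ((t : WithTop ℝ) + b)) =
      secTerm q (toEReal a) (toEReal b) := by
  lift a to ℝ using ha
  induction b using WithTop.recTopCoe with
  | top => simp [secTerm_top hq]
  | coe b =>
    simp only [← WithTop.coe_add, toEReal_coe, secTerm, ← EReal.coe_mul, ← EReal.coe_sub]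
    congr 2
    ring

lemma discrepancyTerm_eq {K : Type*} [Field K] (p e : ℕ) (v : AddValuation K (WithTop ℝ))
    (ψ : K → K) (f : K) :
    discrepancyTerm p e v ψ f = secTerm ((p : ℝ) ^ e) (toEReal (v f)) (toEReal (v (ψ f))) := rfl

lemma secVal_eq_zero_of_isCenter (hV : IsAffineOpen V) (ζ : bethOpen V) {z : X} (hz : z ∈ V)
    (h : ζ.1.IsCenter z) {s : Γ(X, V)} (hs : z ∈ X.basicOpen s) : secVal ζ s = 0 :=
  le_antisymm (not_lt.1 fun h' => ((isCenter_iff hV ζ hz).1 h s).1 h' hs) (secVal_nonneg ζ s)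

lemma _root_.AddValuation.pow_coe {K : Type*} [Field K] (v : AddValuation K (WithTop ℝ)) {x : K}
    {t : ℝ} (hx : v x = t) (n : ℕ) : v (x ^ n) = ((n * t : ℝ) : WithTop ℝ) := by
  rw [AddValuation.map_pow, hx, ← WithTop.coe_nsmul, nsmul_eq_mul]

variable [IsIntegral X] {p : ℕ}

/-- The log discrepancy in terms of sections over an affine open subset. -/
noncomputable def sectionLogDiscrepancy (D : CartierSubalgebra p X) (V : X.Opens) [Nonempty V]
    (ζ : bethOpen V) : EReal :=
  ⨆ (e : ℕ) (_ : 1 ≤ e) (ψ ∈ D.sections e V) (f : Γ(X, V)) (b : Γ(X, V))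
    (_ : X.germToFunctionField V b = ψ (X.germToFunctionField V f)),
    secTerm ((p : ℝ) ^ e) (ev V f ζ) (ev V b ζ)

variable {D : CartierSubalgebra p X}

lemma le_sectionLogDiscrepancy [Nonempty V] (ζ : bethOpen V) {e : ℕ} (he : 1 ≤ e)
    {ψ : X.functionField →+ X.functionField} (hψ : ψ ∈ D.sections e V) {f b : Γ(X, V)}
    (h : X.germToFunctionField V b = ψ (X.germToFunctionField V f)) :
    secTerm ((p : ℝ) ^ e) (ev V f ζ) (ev V b ζ) ≤ sectionLogDiscrepancy D V ζ :=
  le_iSup_of_le e <| le_iSup_of_le he <| le_iSup_of_le ψ <| le_iSup_of_le hψ <|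
    le_iSup_of_le f <| le_iSup_of_le b <| le_iSup_of_le h le_rfl

lemma lowerSemicontinuous_sectionLogDiscrepancy (hp : 1 < p) [Nonempty V] :
    @LowerSemicontinuous _ _ (bethOpenTopology V) _ (sectionLogDiscrepancy D V) := by
  let := bethOpenTopology V
  refine lowerSemicontinuous_iSup fun e => lowerSemicontinuous_iSup fun he =>
    lowerSemicontinuous_iSup fun ψ => lowerSemicontinuous_iSup fun hψ =>
    lowerSemicontinuous_iSup fun f => lowerSemicontinuous_iSup fun b =>
    lowerSemicontinuous_iSup fun h => ?_
  refine lowerSemicontinuous_secTerm ?_ (continuous_ev f) (continuous_ev b) (ev_nonneg b)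
  exact one_lt_pow₀ (by exact_mod_cast hp) (by omega)

/-- Clearing denominators introduces `s`, a unit at the center and hence of value `0`, and `t`, a
unit only at the home. The value of `t` is merely finite, but it cancels by `secTerm_cancel`. -/
lemma discrepancyTerm_le_sectionLogDiscrepancy (hp : 1 < p) (hV : IsAffineOpen V) [Nonempty V]
    (ζ : bethOpen V) {z : X} (hz : z ∈ V) (hc : ζ.1.IsCenter z) {e : ℕ} (he : 1 ≤ e)
    {ψ : X.functionField →+ X.functionField} (hψ : ψ ∈ D.stalk e z)
    {φ : X.residueField ζ.1.home →+ X.residueField ζ.1.home} (hφ : Induces ζ.1.home ψ φ)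
    {k : X.residueField ζ.1.home} (hk : k ≠ 0) :
    discrepancyTerm p e ζ.1.val φ k ≤ sectionLogDiscrepancy D V ζ := by
  obtain ⟨a, rfl⟩ := X.residue_surjective ζ.1.home k
  obtain ⟨c, hc1, hc2⟩ := hφ a
  obtain ⟨hy, s, t, f, b, ψ', hs, ht, hψ', hb, hf1, hb1⟩ := D.exists_sections hV hp hc.1 hz hψ hc1
  have hs0 : secVal ζ s = 0 := secVal_eq_zero_of_isCenter hV ζ hz hc hs
  have ht0 : secVal ζ t ≠ ⊤ := fun h => (secVal_eq_top_iff ζ t).1 h ht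
  obtain ⟨τ, hτ⟩ := WithTop.ne_top_iff_exists.1 ht0
  have hq : 1 < (p : ℝ) ^ e := one_lt_pow₀ (by exact_mod_cast hp) (by omega)
  refine le_trans (le_of_eq ?_) (le_sectionLogDiscrepancy ζ he hψ' hb)
  rw [discrepancyTerm_eq, ev_eq, ev_eq]
  have h1 : secVal ζ f = ζ.1.val (X.residue ζ.1.home a) + ((p : ℝ) ^ e * τ : ℝ) := by
    rw [secVal, hf1, AddValuation.map_mul, ζ.1.val.pow_coe hτ.symm]
    push_cast
    rfl
  have h2 : secVal ζ b = (τ : WithTop ℝ) + ζ.1.val (φ (X.residue ζ.1.home a)) := by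
    rw [secVal, hb1, AddValuation.map_mul, AddValuation.map_mul, hc2, hτ]
    show secVal ζ s + secVal ζ t + _ = _
    rw [hs0, zero_add]
  rw [h1, h2, secTerm_cancel hq _ _ (by rwa [Ne, AddValuation.top_iff])]

/-- Incompatibility yields a section `f` vanishing at the home whose image under some `ψ` does not
vanish there, hence a term `∞ - (finite)`. -/
lemma sectionLogDiscrepancy_eq_top (hp : 1 < p) (hV : IsAffineOpen V) [Nonempty V]
    (ζ : bethOpen V) (h : ¬ UniformlyCompatible D ζ.1.home) :
    sectionLogDiscrepancy D V ζ = ⊤ := by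
  have hyV := home_mem_of_mem_bethOpen ζ.2
  unfold UniformlyCompatible at h
  push Not at h
  obtain ⟨z, hz, e, he, ψ, hψ, a, ha, hab⟩ := h
  obtain ⟨b, hb⟩ := D.exists_stalk_eq hψ a
  have hb0 : stalkToResidueField hz b ≠ 0 := fun h => hab b h hb
  -- The point `z` witnessing incompatibility may lie outside `V`, so all germs are first moved to
  -- the home, which lies in `V`.
  obtain ⟨hy, s, t, f, b', ψ', hs, ht, hψ', hb', hf1, hb1⟩ :=
    D.exists_sections (a := X.presheaf.stalkSpecializes hz a)
      (c := X.presheaf.stalkSpecializes hz b) hV hp specializes_rfl hyV (D.stalk_mono hz hψ)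
      (by rw [algebraMap_stalkSpecializes, algebraMap_stalkSpecializes, hb])
  have hf0 : secVal ζ f = ⊤ := by
    have : X.residue _ (X.presheaf.stalkSpecializes hz a) = 0 := ha
    rw [secVal, hf1, this, zero_mul, AddValuation.map_zero]
  have hb0' : secVal ζ b' ≠ ⊤ := by
    rw [secVal, hb1, Ne, AddValuation.top_iff]
    refine mul_ne_zero (mul_ne_zero ?_ ?_) hb0
    · rwa [X.evaluation_ne_zero_iff_mem_basicOpen]
    · rwa [X.evaluation_ne_zero_iff_mem_basicOpen]
  obtain ⟨τ, hτ⟩ := WithTop.ne_top_iff_exists.1 hb0'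
  have hq : 1 < (p : ℝ) ^ e := one_lt_pow₀ (by exact_mod_cast hp) (by omega)
  refine top_unique (le_trans (le_of_eq ?_) (le_sectionLogDiscrepancy ζ he hψ' hb'))
  rw [ev_eq, ev_eq, hf0, ← hτ, toEReal_top, toEReal_coe, top_secTerm hq]

/-- If `ζ(b) = ∞` the term is `-∞`. Otherwise compatibility makes `ψ` induce a map on the residue
field of the home, nonzero as `b` does not vanish there, and the term is the one with `n = 1`. -/
lemma secTerm_le_logDiscrepancy (hp : 1 < p) (hV : IsAffineOpen V) [Nonempty V] (ζ : bethOpen V)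
    (hcomp : UniformlyCompatible D ζ.1.home) {e : ℕ} (he : 1 ≤ e)
    {ψ : X.functionField →+ X.functionField} (hψ : ψ ∈ D.sections e V) {f b : Γ(X, V)}
    (h : X.germToFunctionField V b = ψ (X.germToFunctionField V f)) :
    secTerm ((p : ℝ) ^ e) (ev V f ζ) (ev V b ζ) ≤ logDiscrepancy D ζ.1 := by
  have hq : 1 < (p : ℝ) ^ e := one_lt_pow₀ (by exact_mod_cast hp) (by omega)
  by_cases hb : secVal ζ b = ⊤
  · rw [ev_eq ζ b, hb, toEReal_top, secTerm_top hq]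
    exact bot_le
  obtain ⟨z, hz, hc⟩ := exists_isCenter hV ζ
  have hy := home_mem_of_mem_bethOpen ζ.2
  have hψz : ψ ∈ D.stalk e z := ⟨V, inferInstance, hz, hψ⟩
  have hψy : ψ ∈ D.stalk e ζ.1.home := ⟨V, inferInstance, hy, hψ⟩
  have hres : ∀ a : X.presheaf.stalk ζ.1.home,
      stalkToResidueField specializes_rfl a = X.residue _ a := by
    intro a
    rw [stalkToResidueField_eq, TopCat.Presheaf.stalkSpecializes_refl]
    rfl
  have hpres : ∀ a b : X.presheaf.stalk ζ.1.home,
      algebraMap (X.presheaf.stalk ζ.1.home) X.functionField b =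
        ψ (algebraMap (X.presheaf.stalk ζ.1.home) X.functionField a) →
      X.residue ζ.1.home a = 0 → X.residue ζ.1.home b = 0 := by
    intro a b hab ha
    obtain ⟨b', hb', hb''⟩ := hcomp ζ.1.home specializes_rfl e he ψ hψy a ((hres a).trans ha)
    have : b = b' := IsFractionRing.injective _ X.functionField (hab.trans hb''.symm)
    rw [this, ← hres, hb']
  obtain ⟨φ, hφ⟩ := exists_induces (D.exists_stalk_eq hψy) hpres
  have hfb : algebraMap (X.presheaf.stalk ζ.1.home) X.functionField (X.presheaf.germ V _ hy b) =
      ψ (algebraMap (X.presheaf.stalk ζ.1.home) X.functionField (X.presheaf.germ V _ hy f)) := by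
    rw [Scheme.algebraMap_germ_eq_germToFunctionField,
      Scheme.algebraMap_germ_eq_germToFunctionField, h]
  have hφf : φ (X.evaluation V _ hy f) = X.evaluation V _ hy b := by
    obtain ⟨c, hc1, hc2⟩ := hφ (X.presheaf.germ V _ hy f)
    have : c = X.presheaf.germ V _ hy b :=
      IsFractionRing.injective _ X.functionField (hc1.trans hfb.symm)
    rw [this] at hc2
    exact hc2
  have hb0 : X.evaluation V _ hy b ≠ 0 := by
    rwa [Ne, ← AddValuation.top_iff ζ.1.val]
  have hf0 : X.evaluation V _ hy f ≠ 0 := by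
    intro h0
    rw [h0, map_zero] at hφf
    exact hb0 hφf.symm
  have hφ0 : φ ≠ 0 := by
    rintro rfl
    exact hb0 hφf.symm
  rw [logDiscrepancy, if_pos hcomp]
  refine le_iSup_of_le z <| le_iSup_of_le hc <| le_iSup_of_le e <| le_iSup_of_le he <|
    le_iSup_of_le φ <| le_iSup_of_le ⟨ψ, hψz, hφ⟩ <| le_iSup_of_le hφ0 ?_
  refine le_iSup_of_le 1 <| le_iSup_of_le le_rfl <| le_iSup_of_le _ <| le_iSup_of_le hf0 ?_
  rw [discrepancyTerm_eq, one_mul, Function.iterate_one, hφf]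
  rfl

/-- The log discrepancy can be computed on an affine open neighborhood of the center. -/
theorem logDiscrepancy_eq [X.IsSeparated] (hp : 1 < p) (hV : IsAffineOpen V) [Nonempty V]
    (ζ : bethOpen V) : logDiscrepancy D ζ.1 = sectionLogDiscrepancy D V ζ := by
  by_cases hcomp : UniformlyCompatible D ζ.1.home
  · refine le_antisymm ?_ ?_
    · rw [logDiscrepancy, if_pos hcomp]
      refine iSup_le fun z => iSup_le fun hz => iSup_le fun e => iSup_le fun he =>
        iSup_le fun φ => iSup_le fun hφ => iSup_le fun _ => iSup_le fun n => iSup_le fun hn =>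
        iSup_le fun k => iSup_le fun hk => ?_
      obtain ⟨ψ, hψ, hψφ⟩ := hφ
      obtain ⟨z', hz', hc'⟩ := exists_isCenter hV ζ
      obtain rfl := hz.unique hc'
      -- The iterate `φ ^ n` is induced by `ψ ^ n`, which lies in degree `n * e` of `D`; thus the
      -- supremum over `n` is absorbed into that over degrees.
      have := discrepancyTerm_le_sectionLogDiscrepancy hp hV ζ hz' hz (Nat.mul_pos hn he)
        (D.pow_mem_stalk hψ hn) (Induces.pow hψφ n) hk
      have hpow := AddMonoid.End.coe_pow (M := X.residueField ζ.1.home) φ n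
      exact (congrArg (fun g => discrepancyTerm p (n * e) ζ.1.val g k) hpow).ge.trans this
    · exact iSup_le fun e => iSup_le fun he => iSup_le fun ψ => iSup_le fun hψ => iSup_le fun f =>
        iSup_le fun b => iSup_le fun h => secTerm_le_logDiscrepancy hp hV ζ hcomp he hψ h
  · rw [sectionLogDiscrepancy_eq_top hp hV ζ hcomp, logDiscrepancy, if_neg hcomp]

end BethMLD

/-! ### The constructible topology. -/

/-- The topology is generated by certain open and certain closed sets, and finite intersections of
these are locally closed. -/
lemma exists_isLocallyClosed_of_mem_nhds_constructibleTopology {X : Type*} [TopologicalSpace X]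
    {x : X} {s : Set X} (hs : s ∈ @nhds X (constructibleTopology X) x) :
    ∃ G : Set X, IsLocallyClosed G ∧ x ∈ G ∧ G ⊆ s := by
  have hb := @TopologicalSpace.isTopologicalBasis_of_subbasis X (constructibleTopology X) _ rfl
  obtain ⟨_, ⟨F, ⟨hF, hFs⟩, rfl⟩, hxG, hGs⟩ :=
    (@IsTopologicalBasis.mem_nhds_iff X (constructibleTopology X) _ _ _ hb).1 hs
  refine ⟨⋂₀ F, ?_, hxG, hGs⟩
  clear hxG hGs hb hs
  induction F, hF using Set.Finite.induction_on with
  | empty => simpa using isClosed_univ.isLocallyClosed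
  | insert _ _ ih =>
    rw [Set.sInter_insert]
    refine IsLocallyClosed.inter ?_ (ih fun _ h => hFs (Set.mem_insert_of_mem _ h))
    rcases hFs (Set.mem_insert _ _) with h | h
    · exact h.1.isLocallyClosed
    · exact h.1.isLocallyClosed

/-- In a Noetherian space all opens are quasi-compact, hence clopen in the constructible topology;
they separate points by `T0`. -/
lemma t2Space_constructibleTopology (X : Type*) [TopologicalSpace X] [T0Space X]
    [NoetherianSpace X] : @T2Space X (constructibleTopology X) := by
  refine @T2Space.mk X (constructibleTopology X) fun x y hxy => ?_
  obtain ⟨U, hU, hxU⟩ := exists_isOpen_xor_mem hxy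
  have h1 : IsOpen[constructibleTopology X] U :=
    (NoetherianSpace.isCompact U).isOpen_constructibleTopology_of_isOpen hU
  have h2 : IsOpen[constructibleTopology X] Uᶜ :=
    (NoetherianSpace.isCompact Uᶜᶜ).isOpen_constructibleTopology_of_isClosed hU.isClosed_compl
  rcases hxU with h | h
  · exact ⟨U, Uᶜ, h1, h2, h.1, h.2, disjoint_compl_right⟩
  · exact ⟨Uᶜ, U, h2, h1, h.2, h.1, disjoint_compl_left⟩

/-! ### `ℤ`-semivaluations, the center map and the minimal log discrepancy. -/

namespace BethMLD

variable {X : Scheme.{u}} {V : X.Opens}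

/-- The semivaluations whose values on the local ring of the center lie in `{0} ∪ [1, ∞]`. -/
def gapSemivaluations (X : Scheme.{u}) : Set (Semivaluation X) :=
  {ζ | ∀ (z : X) (h : ζ.home ⤳ z), ζ.IsCenter z → ∀ a,
    ζ.val (stalkToResidueField h a) = 0 ∨ 1 ≤ ζ.val (stalkToResidueField h a)}

lemma toEReal_one : toEReal 1 = 1 := rfl

lemma mem_gapSemivaluations_iff [X.IsSeparated] (hV : IsAffineOpen V) (ζ : bethOpen V) :
    ζ.1 ∈ gapSemivaluations X ↔ ∀ f, ev V f ζ ∈ ({0} ∪ Set.Ici 1 : Set EReal) := by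
  have hev : ∀ f, ev V f ζ ∈ ({0} ∪ Set.Ici 1 : Set EReal) ↔ secVal ζ f = 0 ∨ 1 ≤ secVal ζ f := by
    intro f
    rw [ev_eq, Set.mem_union, Set.mem_singleton_iff, Set.mem_Ici, ← toEReal_zero, ← toEReal_one,
      toEReal_le, toEReal_injective.eq_iff]
  simp only [hev]
  constructor
  · intro h f
    obtain ⟨z, hz, hc⟩ := exists_isCenter hV ζ
    have := h z hc.1 hc (X.presheaf.germ V z hz f)
    rwa [stalkToResidueField_germ hc.1 hz] at this
  · intro h z hs hc a
    obtain ⟨z', hz, hc'⟩ := exists_isCenter hV ζ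
    obtain rfl := hc.unique hc'
    obtain ⟨f, s, hs', hfs⟩ := exists_mul_germ_eq hV hz a
    have h1 := congrArg (fun a => ζ.1.val (stalkToResidueField hs a)) hfs
    simp only [map_mul, stalkToResidueField_germ, AddValuation.map_mul] at h1
    have h3 : ζ.1.val (stalkToResidueField hs a) + secVal ζ s = secVal ζ f := h1
    rw [secVal_eq_zero_of_isCenter hV ζ hz hc hs', add_zero] at h3
    rw [h3]
    exact h f

lemma isClosed_gapSemivaluations [X.IsSeparated] : IsClosed (gapSemivaluations X) := by
  refine isClosed_iSup_iff.2 fun V => isClosed_coinduced.2 ?_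
  have : (Subtype.val : bethOpen V.1 → Semivaluation X) ⁻¹' gapSemivaluations X =
      ⋂ f, ev V.1 f ⁻¹' ({0} ∪ Set.Ici 1) := by
    ext ζ
    rw [Set.mem_preimage, mem_gapSemivaluations_iff V.2, Set.mem_iInter]
    rfl
  rw [this]
  let := bethOpenTopology V.1
  exact isClosed_iInter fun f => (isClosed_singleton.union isClosed_Ici).preimage (continuous_ev f)

/-- This gap is all that is used of integrality: it makes `ζ(f) > 0` equivalent to the closed
condition `ζ(f) ≥ 1`. -/
lemma zSemivaluations_subset [X.IsSeparated] [IsIntegral X] :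
    zSemivaluations X ⊆ gapSemivaluations X := by
  refine closure_minimal ?_ isClosed_gapSemivaluations
  rintro ζ ⟨-, hζ⟩ z hs hc a
  by_cases ha : stalkToResidueField hs a = 0
  · rw [ha, AddValuation.map_zero]
    exact Or.inr le_top
  · obtain ⟨n, hn⟩ := hζ _ ha
    have h0 := (hc.2 a).1
    rw [hn] at h0 ⊢
    rw [← WithTop.coe_zero, ← WithTop.coe_one, WithTop.coe_le_coe, WithTop.coe_inj] at *
    norm_cast at *
    omega

variable [IsIntegral X] {p : ℕ}

lemma isClosed_preimage_zSemivaluations (hV : IsAffineOpen V) :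
    @IsClosed (bethOpen V) (bethOpenTopology V) (Subtype.val ⁻¹' zSemivaluations X) :=
  @IsClosed.preimage _ _ (bethOpenTopology V) bethTopology _ (continuous_bethOpen_val hV) _
    isClosed_closure

/-- This makes the fibres of the center map nonempty, without which the infimum could not be
attained. -/
lemma exists_zValuation_isCenter [IsLocallyNoetherian X] (x : X) :
    ∃ ζ ∈ zValuations X, ζ.IsCenter x := by
  have hs : genericPoint X ⤳ x := (genericPoint_spec X).specializes trivial
  let : Algebra (X.presheaf.stalk x) (X.residueField (genericPoint X)) :=
    (stalkToResidueField hs).toAlgebra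
  have hres : ∀ a : X.presheaf.stalk x,
      algebraMap (X.presheaf.stalk x) (X.residueField (genericPoint X)) a =
        X.residue (genericPoint X) (algebraMap (X.presheaf.stalk x) X.functionField a) :=
    fun a => rfl
  have hinj : Function.Injective (X.residue (genericPoint X)) := by
    have : Function.Injective ((X.residue (genericPoint X)).hom :
      X.functionField →+* X.residueField (genericPoint X)) := RingHom.injective _
    exact this
  have : FaithfulSMul (X.presheaf.stalk x) (X.residueField (genericPoint X)) :=
    (faithfulSMul_iff_algebraMap_injective _ _).2
      (hinj.comp (IsFractionRing.injective (X.presheaf.stalk x) X.functionField))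
  have : IsFractionRing (X.presheaf.stalk x) (X.residueField (genericPoint X)) := by
    refine IsFractionRing.of_field _ _ fun z => ?_
    obtain ⟨l, rfl⟩ := X.residue_surjective _ z
    obtain ⟨a, b, -, hab⟩ := IsFractionRing.div_surjective (A := X.presheaf.stalk x)
      (l : X.functionField)
    refine ⟨a, b, ?_⟩
    rw [hres, hres, ← hab]
    exact map_div₀ ((X.residue (genericPoint X)).hom :
      X.functionField →+* X.residueField (genericPoint X)) _ _
  obtain ⟨v, hv1, hv2⟩ := IsLocalRing.exists_addValuation_int (X.presheaf.stalk x)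
    (X.residueField (genericPoint X))
  exact ⟨⟨genericPoint X, v, x, hs, fun a => (hv2 a).1⟩, ⟨rfl, hv1⟩, hs, hv2⟩

variable [IsNoetherian X] [X.IsSeparated] {D : CartierSubalgebra p X}

/-- A lower semicontinuous function attains its minimum on a nonempty compact set, here the fibre of
the center map over `x`. -/
theorem exists_logDiscrepancy_eq_mld (hp : 1 < p) (x : X) :
    ∃ ζ ∈ zSemivaluations X, ζ.IsCenter x ∧ logDiscrepancy D ζ = mld D x := by
  obtain ⟨V, hV, hx, -⟩ := exists_isAffineOpen_mem_and_subset (U := (⊤ : X.Opens)) (x := x) trivial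
  have : Nonempty V := ⟨⟨x, hx⟩⟩
  let K : Set (bethOpen V) := {ζ | ζ.1 ∈ zSemivaluations X ∧ ζ.1.IsCenter x}
  -- By the gap, having center `x` is described by closed conditions only.
  have hK : K = (Subtype.val ⁻¹' zSemivaluations X) ∩
      ⋂ f : Γ(X, V), {ζ | (x ∈ X.basicOpen f → ev V f ζ ∈ ({0} : Set EReal)) ∧
        (x ∉ X.basicOpen f → ev V f ζ ∈ Set.Ici (1 : EReal))} := by
    ext ζ
    refine and_congr_right fun hζ => ?_
    rw [isCenter_iff hV ζ hx, Set.mem_iInter]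
    refine forall_congr' fun f => ?_
    have h1 := (mem_gapSemivaluations_iff hV ζ).1 (zSemivaluations_subset hζ) f
    have h2 : 0 < secVal ζ f ↔ 0 < ev V f ζ := by rw [ev_eq, ← toEReal_zero, toEReal_lt]
    rw [h2]
    rcases h1 with h1 | h1
    · have h1' : ev V f ζ = 0 := h1
      simp [h1', (zero_lt_one (α := EReal)).not_ge]
    · have h1' : (1 : EReal) ≤ ev V f ζ := h1
      have h3 : 0 < ev V f ζ := zero_lt_one.trans_le h1'
      simp [h1', h3, h3.ne']
  have hKne : K.Nonempty := by
    obtain ⟨ζ, hζ, hc⟩ := exists_zValuation_isCenter x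
    exact ⟨⟨ζ, mem_bethOpen_of_isCenter hc hx⟩, subset_closure hζ, hc⟩
  let := bethOpenTopology V
  have := compactSpace_bethOpen hV
  have hKc : IsCompact K := by
    refine IsClosed.isCompact ?_
    rw [hK]
    refine (isClosed_preimage_zSemivaluations hV).inter (isClosed_iInter fun f => ?_)
    refine IsClosed.inter (isClosed_imp isOpen_const ?_) (isClosed_imp isOpen_const ?_)
    · exact isClosed_singleton.preimage (continuous_ev f)
    · exact isClosed_Ici.preimage (continuous_ev f)
  obtain ⟨ζ, hζ, hmin⟩ := LowerSemicontinuousOn.exists_isMinOn hKne hKc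
    ((lowerSemicontinuous_sectionLogDiscrepancy (D := D) hp).lowerSemicontinuousOn K)
  refine ⟨ζ.1, hζ.1, hζ.2, le_antisymm ?_ (iInf₂_le_of_le ζ.1 hζ.1 (iInf_le _ hζ.2))⟩
  refine le_iInf₂ fun ξ hξ => le_iInf fun hc => ?_
  have := hmin (show (⟨ξ, mem_bethOpen_of_isCenter hc hx⟩ : bethOpen V) ∈ K from ⟨hξ, hc⟩)
  rw [logDiscrepancy_eq hp hV ζ, logDiscrepancy_eq hp hV ⟨ξ, mem_bethOpen_of_isCenter hc hx⟩]
  exact this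

/-- The center map is continuous on the compact set `K` for the Hausdorff constructible topology, so
its image is closed. -/
lemma isClosed_centers (hV : IsAffineOpen V) {K : Set (bethOpen V)}
    (hK : @IsClosed _ (bethOpenTopology V) K) (hKZ : K ⊆ Subtype.val ⁻¹' zSemivaluations X) :
    IsClosed[constructibleTopology X] {x | ∃ ζ ∈ K, ζ.1.IsCenter x} := by
  choose c hcV hc using exists_isCenter hV
  have himg : {x | ∃ ζ ∈ K, ζ.1.IsCenter x} = c '' K := by
    ext x
    exact ⟨fun ⟨ζ, hζ, hx⟩ => ⟨ζ, hζ, (hc ζ).unique hx⟩, fun ⟨ζ, hζ, hx⟩ => ⟨ζ, hζ, hx ▸ hc ζ⟩⟩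
  have hgap : ∀ ζ ∈ K, ∀ f, ev V f ζ < 1 → c ζ ∈ X.basicOpen f := by
    intro ζ hζ f hf
    by_contra h
    have h1 := ((isCenter_iff hV ζ (hcV ζ)).1 (hc ζ) f).2 h
    rw [← toEReal_lt, toEReal_zero, ← ev_eq] at h1
    rcases (mem_gapSemivaluations_iff hV ζ).1 (zSemivaluations_subset (hKZ hζ)) f with h2 | h2
    · exact h1.ne' h2
    · exact hf.not_ge h2
  let := bethOpenTopology V
  have := compactSpace_bethOpen hV
  have hcont : @ContinuousOn _ _ _ (constructibleTopology X) c K := by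
    refine continuousOn_to_generateFrom_iff.2 fun ζ hζ W hW hζW => ?_
    -- For `W` open the gap is essential: `ζ(f) < 1` is an open condition forcing the center into
    -- `X.basicOpen f`. For `W` closed, finitely many `X.basicOpen f` cover `Wᶜ ∩ V`, and the open
    -- conditions `ζ(f) > 0` keep the center out of them.
    rcases hW with ⟨hW, -⟩ | ⟨hW, -⟩
    · obtain ⟨f, hfW, hf⟩ := hV.exists_basicOpen_le (V := ⟨W, hW⟩) ⟨c ζ, hζW⟩ (hcV ζ)
      have h0 : ev V f ζ < 1 := by
        rw [ev_eq, secVal_eq_zero_of_isCenter hV ζ (hcV ζ) (hc ζ) hf]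
        exact zero_lt_one
      refine mem_nhdsWithin.2 ⟨ev V f ⁻¹' Set.Iio 1, isOpen_Iio.preimage (continuous_ev f), h0, ?_⟩
      exact fun ξ hξ => hfW (hgap ξ hξ.2 f hξ.1)
    · let ι := {f : Γ(X, V) // (X.basicOpen f : Set X) ⊆ Wᶜ}
      obtain ⟨T, hT⟩ := (NoetherianSpace.isCompact (Wᶜ ∩ V : Set X)).elim_finite_subcover
        (fun f : ι => (X.basicOpen f.1 : Set X)) (fun f => (X.basicOpen f.1).isOpen) (by
          intro x hx
          obtain ⟨f, hfW, hf⟩ := hV.exists_basicOpen_le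
            (V := ⟨Wᶜ, hW.isOpen_compl⟩) ⟨x, hx.1⟩ hx.2
          exact Set.mem_iUnion.2 ⟨⟨f, hfW⟩, hf⟩)
      refine mem_nhdsWithin.2 ⟨⋂ f ∈ T, ev V f.1 ⁻¹' Set.Ioi 0,
        isOpen_biInter_finset fun f _ => isOpen_Ioi.preimage (continuous_ev f.1), ?_, ?_⟩
      · refine Set.mem_iInter₂.2 fun f _ => ?_
        have h1 := ((isCenter_iff hV ζ (hcV ζ)).1 (hc ζ) f.1).2 fun h => f.2 h hζW
        rwa [← toEReal_lt, toEReal_zero, ← ev_eq] at h1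
      · rintro ξ ⟨hξ, -⟩
        by_contra hW'
        obtain ⟨f, hfT, hf⟩ := Set.mem_iUnion₂.1 (hT ⟨hW', hcV ξ⟩)
        have h1 : 0 < ev V f.1 ξ := Set.mem_iInter₂.1 hξ f hfT
        rw [ev_eq, ← toEReal_zero, toEReal_lt] at h1
        exact ((isCenter_iff hV ξ (hcV ξ)).1 (hc ξ) f.1).1 h1 hf
  rw [himg]
  exact @IsCompact.isClosed X (constructibleTopology X) (t2Space_constructibleTopology X) _
    (@IsCompact.image_of_continuousOn _ _ _ (constructibleTopology X) _ _ hK.isCompact hcont)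

theorem lowerSemicontinuous_mld (hp : 1 < p) :
    @LowerSemicontinuous X EReal (constructibleTopology X) _ (mld D) := by
  refine (@lowerSemicontinuous_iff_isClosed_preimage X (constructibleTopology X) _ _ _).2 fun t => ?_
  choose V hV hxV _ using fun x : X => exists_isAffineOpen_mem_and_subset (U := (⊤ : X.Opens))
    (x := x) trivial
  obtain ⟨S, -, hS⟩ := isCompact_univ.elim_nhds_subcover (fun x => (V x : Set X))
    fun x _ => (V x).isOpen.mem_nhds (hxV x)
  have hne : ∀ x, Nonempty (V x) := fun x => ⟨⟨x, hxV x⟩⟩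
  let K : ∀ x, Set (bethOpen (V x)) := fun x =>
    Subtype.val ⁻¹' zSemivaluations X ∩ sectionLogDiscrepancy D (V x) ⁻¹' Set.Iic t
  -- Attainment of the infimum is needed here: `mld D z ≤ t` must give one semivaluation with log
  -- discrepancy at most `t`, not just one below every larger bound.
  have hK : mld D ⁻¹' Set.Iic t = ⋃ x ∈ S, {z | ∃ ζ ∈ K x, ζ.1.IsCenter z} := by
    ext z
    simp only [Set.mem_preimage, Set.mem_Iic, Set.mem_iUnion]
    constructor
    · intro hz
      obtain ⟨ζ, hζ, hc, hζz⟩ := exists_logDiscrepancy_eq_mld (D := D) hp z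
      obtain ⟨x, hx, hzx⟩ := Set.mem_iUnion₂.1 (hS (Set.mem_univ z))
      have hζx : ζ ∈ bethOpen (V x) := mem_bethOpen_of_isCenter hc hzx
      refine ⟨x, hx, ⟨ζ, hζx⟩, ⟨hζ, ?_⟩, hc⟩
      have := logDiscrepancy_eq (D := D) hp (hV x) ⟨ζ, hζx⟩
      exact (this.symm.trans hζz).le.trans hz
    · rintro ⟨x, hx, ζ, ⟨hζ, hζt⟩, hc⟩
      refine (iInf₂_le_of_le ζ.1 hζ (iInf_le _ hc)).trans ?_
      rw [logDiscrepancy_eq hp (hV x)]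
      exact hζt
  rw [hK]
  refine @isClosed_biUnion_finset X _ (constructibleTopology X) _ _ fun x _ =>
    isClosed_centers (hV x) ?_ Set.inter_subset_left
  let := bethOpenTopology (V x)
  exact (isClosed_preimage_zSemivaluations (hV x)).inter
    ((lowerSemicontinuous_sectionLogDiscrepancy (D := D) hp).isClosed_preimage t)

end BethMLD

theorem mainTheorem8 (p : ℕ) [Fact p.Prime] (X : Scheme.{u}) [IsIntegral X] [IsNoetherian X]
    [X.IsSeparated] [CharP Γ(X, ⊤) p] (D : BethMLD.CartierSubalgebra p X) :
    -- the infimum defining `mld` is a minimum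
    (∀ x : X, ∃ ζ ∈ BethMLD.zSemivaluations X, ζ.IsCenter x ∧
      BethMLD.logDiscrepancy D ζ = BethMLD.mld D x) ∧
    -- lower semicontinuity in the constructible topology
    (@LowerSemicontinuous X EReal (constructibleTopology X) _ (BethMLD.mld D)) ∧
    -- the explicit form, at points where `mld` is finite
    (∀ (x : X) (ε : ℝ), 0 < ε → BethMLD.mld D x ≠ ⊥ → BethMLD.mld D x ≠ ⊤ →
      ∃ G : Set X, IsLocallyClosed G ∧ x ∈ G ∧
        ∀ x' ∈ G, BethMLD.mld D x - (ε : EReal) < BethMLD.mld D x') ∧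
    -- the explicit form, at points where `mld` is `+∞`
    (∀ (x : X) (M : ℝ), BethMLD.mld D x = ⊤ →
      ∃ G : Set X, IsLocallyClosed G ∧ x ∈ G ∧ ∀ x' ∈ G, (M : EReal) < BethMLD.mld D x') := by
  have hp : 1 < p := (Fact.out : p.Prime).one_lt
  have hlsc := BethMLD.lowerSemicontinuous_mld (D := D) hp
  have hG : ∀ (x : X) (t : EReal), t < BethMLD.mld D x →
      ∃ G : Set X, IsLocallyClosed G ∧ x ∈ G ∧ ∀ x' ∈ G, t < BethMLD.mld D x' := fun x t ht =>
    exists_isLocallyClosed_of_mem_nhds_constructibleTopology (hlsc x t ht)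
  refine ⟨BethMLD.exists_logDiscrepancy_eq_mld hp, hlsc, fun x ε hε h1 h2 => hG x _ ?_,
    fun x M hM => hG x _ (hM ▸ EReal.coe_lt_top M)⟩
  lift BethMLD.mld D x to ℝ using ⟨h2, h1⟩ with m
  rw [← EReal.coe_sub, EReal.coe_lt_coe_iff]
  linarith
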